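/- Let $M,B$ be smooth finite-dimensional manifolds (Hausdorff, second countable, without boundary) and let $p:M\to B$ be a fibration, i.e. a smooth submersion that admits a complete Ehresmann connection, with connected (non-empty) fibres. Put $\mathrm{Ver}=\ker dp$ and $\Omega^{r,s}=\Omega^r(B,\Omega^s(\mathrm{Ver}))$. An Ehresmann connection, with horizontal lift $h:\mathfrak X(B)\to\mathfrak X(M)$ and curvature $C(u,v)=[h(u),h(v)]-h([u,v])$, identifies $\Omega^k(M)$ with $\bigoplus_{r+s=k}\Omega^{r,s}$ through $\Phi^{(r,s)}(v_1,\dots,v_r)(w_1,\dots,w_s)=\Phi(h(v_1),\dots,h(v_r),w_1,\dots,w_s)$, and the de Rham differential becomes $d=d^V+d^H+d^C$, where $d^V:\Omega^{r,s}\to\Omega^{r,s+1}$ is $(-1)^r$ times the vertical de Rham differential, $$(d^H\Theta)(v_0,\dots,v_r)=\sum_i(-1)^iL_{h(v_i)}\bigl(\Theta(\dots\widehat{v_i}\dots)\bigr)+\sum_{i<j}(-1)^{i+j}\Theta([v_i,v_j],\dots\widehat{v_i}\dots\widehat{v_j}\dots),$$ $$(d^C\Theta)(v_0,\dots,v_{r+1})=(-1)^r\sum_{i<j}(-1)^{i+j}\,i_{C(v_i,v_j)}\Theta(\dots\widehat{v_i}\dots\widehat{v_j}\dots).$$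 Let $[x]_1$ denote the class of a $d^V$-closed $x\in\Omega^{r,s}$ in $\Omega^r(B,H^s(\mathrm{Ver}))$ (that is, modulo $d^V\Omega^{r,s-1}$), and $[x]_2$ its class in $H^r(B,H^s(\mathrm{Ver}))$ (that is, modulo $d^H\{y\in\Omega^{r-1,s}: d^Vy=0\}+d^V\Omega^{r,s-1}$) when $[x]_1$ is a cocycle for the differential induced by $d^H$. Let $(p,\Phi_V)$ be a $2$-plectic fibration: $\Phi_V\in\Omega^3(\mathrm{Ver})$ satisfies $d^V\Phi_V=0$, is nondegenerate (a vertical vector $X$ with $i_X\Phi_V=0$ is zero), and there is a compatible connection, i.e. one with $d^H\Phi_V=0$. Fix a compatible connection. Suppose that the first obstruction $[d^C\Phi_V]_2\in H^2(B,H^2(\mathrm{Ver}))$ vanishes. Then there are $\alpha_H^\star\in\Omega^{1,2}$ and $\omega_H^\star\in\Omega^{2,1}$ with $$d^H\Phi_V+d^V\alpha_H^\star=0,\qquad d^C\Phi_V+d^H\alpha_H^\star+d^V\omega_H^\star=0.\tag{1}$$ Moreover, for every solution $\alpha_H^\star,\omega_H^\star$ of (1) whose second obstruction $[d^H\omega_H^\star+d^C\alpha_H^\star]_1\in\Omega^3(B,H^1(\mathrm{Ver}))$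 vanishes, there is $\Phi_H\in\Omega^{3,0}=\Omega^3(B,C^\infty(M))$ with $$d^C\alpha_H^\star+d^H\omega_H^\star+d^V\Phi_H=0,\tag{2}$$ and for every solution $\Phi_H$ of (2): (a) $d^H\Phi_H+d^C\omega_H^\star=p^*\varphi$ for a unique closed form $\varphi\in\Omega^4(B)$; this defines the third obstruction $[\varphi]=[d^H\Phi_H+d^C\omega_H^\star]\in H^4(B)$; (b) $[\varphi]=0$ if and only if there is a closed form $\Phi\in\Omega^3(M)$ that restricts to $\Phi_V$ on the fibres and has $(1,2)$-component $\alpha_H^\star$ and $(2,1)$-component $\omega_H^\star$; (c) in particular, if $[\varphi]=0$, then $\Phi_V$ admits a closed extension, i.e. a closed $\Phi\in\Omega^3(M)$ that restricts to $\Phi_V$ on the fibres. -/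

import Mathlib

open scoped Manifold ContDiff

noncomputable section

namespace TwoPlectic

/-! ### Smooth functions, vector fields and the Koszul formula

Throughout, `M` is a smooth manifold modelled on a finite-dimensional real vector space `E`.
Vector fields are derivations of the algebra of smooth functions, and a `k`-form is an alternating
map on vector fields that is multilinear over smooth functions. For finite-dimensional Hausdorff
manifolds these are exactly the smooth vector fields and the smooth differential forms. -/

section Manifold

variable (E : Type*) [NormedAddCommGroup E] [NormedSpace ℝ E]
  (M : Type*) [TopologicalSpace M] [ChartedSpace E M]

/-- The algebra `C^∞(M)` of smooth real functions on `M`. -/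
abbrev Fn := C^∞⟮𝓘(ℝ, E), M; ℝ⟯

/-- The `C^∞(M)`-module and real Lie algebra `𝔛(M)` of smooth vector fields on `M`. -/
abbrev VField := Derivation ℝ (Fn E M) (Fn E M)

/-- The space `Ω^k(M)` of differential `k`-forms on `M`. -/
abbrev Form (k : ℕ) := VField E M [⋀^Fin k]→ₗ[Fn E M] Fn E M

instance (k : ℕ) : AddCommGroup (Form E M k) := inferInstance

end Manifold

/-- The first sum of the Koszul formula,
`∑_i (-1)^i ρ(x_i) (c (x_0, …, x̂_i, …, x_k))`. -/
def koszulAction {L A : Type*} [AddCommGroup A] [Module ℝ A] (ρ : L → Module.End ℝ A) {k : ℕ}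
    (c : (Fin k → L) → A) (x : Fin (k + 1) → L) : A :=
  ∑ i : Fin (k + 1), (-1 : ℝ) ^ (i : ℕ) • ρ (x i) (c fun l => x (i.succAbove l))

/-- The second sum of the Koszul formula,
`∑_{i < j} (-1)^(i+j) c ([x_i, x_j], x_0, …, x̂_i, …, x̂_j, …, x_k)`; it is empty for `k = 0`.
For `i < j` the index `i` is taken in `Fin (k + 1)`, which makes `l ↦ j.succAbove (i.succAbove l)`
the increasing enumeration of the indices other than `i` and `j`. -/
def koszulBracket {L A : Type*} [Bracket L L] [AddCommGroup A] [Module ℝ A] :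
    {k : ℕ} → ((Fin k → L) → A) → (Fin (k + 1) → L) → A
  | 0, _, _ => 0
  | k + 1, c, x =>
    ∑ j : Fin (k + 2), ∑ i : Fin (k + 1),
      if i.castSucc < j then
        (-1 : ℝ) ^ ((i : ℕ) + (j : ℕ)) •
          c (Fin.cons ⁅x i.castSucc, x j⁆ fun l => x (j.succAbove (i.succAbove l)))
      else 0

/-- The Koszul differential of a cochain `c : L^k → A`, for an operator `ρ(x)` on `A` attached to
every `x : L`:
`(dc)(x_0, …, x_k) = ∑_i (-1)^i ρ(x_i) (c (…, x̂_i, …))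
  + ∑_{i < j} (-1)^(i+j) c ([x_i, x_j], …, x̂_i, …, x̂_j, …)`. -/
def koszul {L A : Type*} [Bracket L L] [AddCommGroup A] [Module ℝ A] (ρ : L → Module.End ℝ A)
    (k : ℕ) : ((Fin k → L) → A) →ₗ[ℝ] ((Fin (k + 1) → L) → A) where
  toFun c x := koszulAction ρ c x + koszulBracket c x
  map_add' c η := by
    funext x
    have h1 : koszulAction ρ (c + η) x = koszulAction ρ c x + koszulAction ρ η x := by
      simp [koszulAction, Finset.sum_add_distrib]
    have h2 : koszulBracket (c + η) x = koszulBracket c x + koszulBracket η x := by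
      cases k with
      | zero => simp [koszulBracket]
      | succ k =>
        simp only [koszulBracket, Pi.add_apply, smul_add, ← Finset.sum_add_distrib]
        refine Finset.sum_congr rfl fun j _ => Finset.sum_congr rfl fun i _ => ?_
        split_ifs <;> simp
    simp only [h1, h2, Pi.add_apply]
    abel
  map_smul' a c := by
    funext x
    have h1 : koszulAction ρ (a • c) x = a • koszulAction ρ c x := by
      simp only [koszulAction, Pi.smul_apply, map_smul, Finset.smul_sum]
      exact Finset.sum_congr rfl fun i _ => smul_comm _ _ _
    have h2 : koszulBracket (a • c) x = a • koszulBracket c x := by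
      cases k with
      | zero => simp [koszulBracket]
      | succ k =>
        simp only [koszulBracket, Pi.smul_apply, Finset.smul_sum]
        refine Finset.sum_congr rfl fun j _ => Finset.sum_congr rfl fun i _ => ?_
        split_ifs
        · exact smul_comm _ _ _
        · simp
    simp only [h1, h2, Pi.smul_apply, RingHom.id_apply, smul_add]

/-! ### De Rham cohomology -/

section DeRham

variable (E : Type*) [NormedAddCommGroup E] [NormedSpace ℝ E]
  (M : Type*) [TopologicalSpace M] [ChartedSpace E M]

/-- The de Rham differential, given by the Koszul formula. -/
def extD (k : ℕ) :
    ((Fin k → VField E M) → Fn E M) →ₗ[ℝ] ((Fin (k + 1) → VField E M) → Fn E M) :=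
  koszul (fun X : VField E M => (X : Fn E M →ₗ[ℝ] Fn E M)) k

variable {E M} in
/-- A form `Φ` is closed if `dΦ = 0`. -/
def IsClosedForm {k : ℕ} (Φ : Form E M k) : Prop := extD E M k Φ = 0

/-- The space of closed `k`-forms. -/
def closedForms (k : ℕ) : Submodule ℝ (Form E M k) where
  carrier := {Φ | IsClosedForm Φ}
  zero_mem' := (extD E M k).map_zero
  add_mem' {a b} ha hb := by
    have := (extD E M k).map_add a b
    rw [show extD E M k a = 0 from ha, show extD E M k b = 0 from hb, add_zero] at this
    exact this
  smul_mem' c a ha := by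
    have := (extD E M k).map_smul c a
    rw [show extD E M k a = 0 from ha, smul_zero] at this
    exact this

/-- The space of exact `(k+1)`-forms, inside the space of closed `(k+1)`-forms. -/
def exactForms (k : ℕ) : Submodule ℝ (closedForms E M (k + 1)) where
  carrier := {Φ | ∃ η : Form E M k, extD E M k η = (Φ : Form E M (k + 1))}
  zero_mem' := ⟨0, (extD E M k).map_zero⟩
  add_mem' := by
    rintro a b ⟨η, hη⟩ ⟨ζ, hζ⟩
    refine ⟨η + ζ, ?_⟩
    have := (extD E M k).map_add η ζ
    rw [hη, hζ] at this
    exact this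
  smul_mem' := by
    rintro c a ⟨η, hη⟩
    refine ⟨c • η, ?_⟩
    have := (extD E M k).map_smul c η
    rw [hη] at this
    exact this

/-- The de Rham cohomology space `H^(k+1)(M)`. -/
abbrev DeRhamSucc (k : ℕ) := closedForms E M (k + 1) ⧸ exactForms E M k

end DeRham

/-! ### The vertical bundle, mixed forms and Ehresmann connections -/

section Fibration

variable {E F : Type*} [NormedAddCommGroup E] [NormedSpace ℝ E]
  [NormedAddCommGroup F] [NormedSpace ℝ F]
  {M B : Type*} [TopologicalSpace M] [ChartedSpace E M] [TopologicalSpace B] [ChartedSpace F B]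

/-- The `C^∞(M)`-module `Γ(Ver)` of sections of `Ver = ker dp`: the vector fields on `M` that
annihilate all functions pulled back from `B`. -/
def Ver (p : C^∞⟮𝓘(ℝ, E), M; 𝓘(ℝ, F), B⟯) : Submodule (Fn E M) (VField E M) where
  carrier := {X | ∀ g : Fn F B, X (g.comp p) = 0}
  zero_mem' _ := rfl
  add_mem' {X Y} hX hY g := by simp [hX g, hY g]
  smul_mem' f X hX g := by simp [hX g]

instance (p : C^∞⟮𝓘(ℝ, E), M; 𝓘(ℝ, F), B⟯) : Bracket (Ver p) (Ver p) where
  bracket X Y := ⟨⁅(X : VField E M), (Y : VField E M)⁆, fun g => by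
    rw [Derivation.commutator_apply, X.2 g, Y.2 g, map_zero, map_zero, sub_zero]⟩

/-- The space `Ω^k(Ver)` of vertical `k`-forms. -/
abbrev VForm (p : C^∞⟮𝓘(ℝ, E), M; 𝓘(ℝ, F), B⟯) (k : ℕ) :=
  Ver p [⋀^Fin k]→ₗ[Fn E M] Fn E M

/-- All functions of `r` vector fields on `B` and `s` vertical vector fields on `M` with values in
`C^∞(M)`. The operators below are given by formulas that make sense on these functions. -/
abbrev Cochain (p : C^∞⟮𝓘(ℝ, E), M; 𝓘(ℝ, F), B⟯) (r s : ℕ) :=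
  (Fin r → VField F B) → (Fin s → Ver p) → Fn E M

/-- `Θ` is an `r`-form on `B` with values in vertical `s`-forms: its values are vertical `s`-forms,
and it is alternating and `C^∞(B)`-multilinear in the vector fields on `B`. -/
structure IsMixedForm (p : C^∞⟮𝓘(ℝ, E), M; 𝓘(ℝ, F), B⟯) {r s : ℕ} (Θ : Cochain p r s) : Prop where
  vertical : ∀ v, ∃ η : VForm p s, Θ v = η
  map_add : ∀ v i u u', Θ (Function.update v i (u + u')) =
    Θ (Function.update v i u) + Θ (Function.update v i u')
  map_smul : ∀ v i (g : Fn F B) u w, Θ (Function.update v i (g • u)) w =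
    g.comp p * Θ (Function.update v i u) w
  alternating : ∀ v i j, i ≠ j → v i = v j → Θ v = 0

/-- The space `Ω^{r,s} = Ω^r(B, Ω^s(Ver))`. -/
def mixedForms (p : C^∞⟮𝓘(ℝ, E), M; 𝓘(ℝ, F), B⟯) (r s : ℕ) : Submodule ℝ (Cochain p r s) where
  carrier := {Θ | IsMixedForm p Θ}
  zero_mem' := ⟨fun _ => ⟨0, rfl⟩, fun _ _ _ _ => by simp, fun _ _ _ _ _ => by simp,
    fun _ _ _ _ _ => rfl⟩
  add_mem' {a b} ha hb := by
    refine ⟨fun v => ?_, fun v i u u' => ?_, fun v i g u w => ?_, fun v i j hij hv => ?_⟩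
    · obtain ⟨η, hη⟩ := ha.vertical v
      obtain ⟨ζ, hζ⟩ := hb.vertical v
      exact ⟨η + ζ, by rw [Pi.add_apply, hη, hζ]; rfl⟩
    · simp only [Pi.add_apply, ha.map_add, hb.map_add]
      abel
    · simp only [Pi.add_apply, ha.map_smul, hb.map_smul, mul_add]
    · simp [ha.alternating v i j hij hv, hb.alternating v i j hij hv]
  smul_mem' c a ha := by
    refine ⟨fun v => ?_, fun v i u u' => ?_, fun v i g u w => ?_, fun v i j hij hv => ?_⟩
    · obtain ⟨η, hη⟩ := ha.vertical v
      exact ⟨c • η, by rw [Pi.smul_apply, hη]; rfl⟩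
    · simp only [Pi.smul_apply, ha.map_add, smul_add]
    · simp only [Pi.smul_apply, ha.map_smul, mul_smul_comm]
    · simp [ha.alternating v i j hij hv]

/-- A vertical form, seen in `Ω^{0,k}`. -/
def VForm.toCochain {p : C^∞⟮𝓘(ℝ, E), M; 𝓘(ℝ, F), B⟯} {k : ℕ} (η : VForm p k) : Cochain p 0 k :=
  fun _ w => η w

/-- The pull-back `p^* φ` of a form on the base, seen in `Ω^{k,0}`. -/
def pullbackForm (p : C^∞⟮𝓘(ℝ, E), M; 𝓘(ℝ, F), B⟯) {k : ℕ} (φ : Form F B k) : Cochain p k 0 :=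
  fun v _ => (φ v).comp p

/-- An Ehresmann connection (a smooth splitting `TM = Ver ⊕ Hor`), given by its horizontal lift: a
`C^∞(B)`-linear map `𝔛(B) → 𝔛(M)` such that the lift of `u` is `p`-related to `u`. The horizontal
space at a point consists of the values there of the lifts. -/
structure EhresmannConnection (p : C^∞⟮𝓘(ℝ, E), M; 𝓘(ℝ, F), B⟯) where
  lift : VField F B → VField E M
  lift_add : ∀ u v, lift (u + v) = lift u + lift v
  lift_smul : ∀ (g : Fn F B) u, lift (g • u) = (g.comp p : Fn E M) • lift u
  lift_apply_comp : ∀ u (g : Fn F B), lift u (g.comp p) = (u g).comp p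

namespace EhresmannConnection

variable {p : C^∞⟮𝓘(ℝ, E), M; 𝓘(ℝ, F), B⟯} (h : EhresmannConnection p)

/-- A curve in `M` is horizontal if its velocity at every time is the value of a horizontal lift. -/
def IsHorizontal (c : ℝ → M) : Prop :=
  ∀ t : ℝ, ∃ u : VField F B, ∀ f : Fn E M, deriv (fun τ => f (c τ)) t = h.lift u f (c t)

/-- The connection is complete: every smooth curve in `B` has a horizontal lift, defined for all
times, through every point of the fibre over its initial point. -/
def IsComplete : Prop :=
  ∀ γ : ℝ → B, ContMDiff 𝓘(ℝ, ℝ) 𝓘(ℝ, F) ∞ γ → ∀ m : M, p m = γ 0 →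
    ∃ c : ℝ → M, ContMDiff 𝓘(ℝ, ℝ) 𝓘(ℝ, E) ∞ c ∧ c 0 = m ∧ (∀ t, p (c t) = γ t) ∧ h.IsHorizontal c

/-- The bracket `[h(u), w]` with a vertical field `w` is vertical. -/
def lieVer (u : VField F B) (w : Ver p) : Ver p :=
  ⟨⁅h.lift u, (w : VField E M)⁆, fun g => by
    rw [Derivation.commutator_apply, w.2 g, h.lift_apply_comp, w.2 (u g), map_zero, sub_zero]⟩

/-- The curvature `C(u, v) = [h(u), h(v)] - h([u, v])`, a vertical vector field. -/
def curvature (u v : VField F B) : Ver p :=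
  ⟨⁅h.lift u, h.lift v⁆ - h.lift ⁅u, v⁆, fun g => by
    rw [Derivation.sub_apply, Derivation.commutator_apply]
    simp only [h.lift_apply_comp, Derivation.commutator_apply]
    exact sub_self _⟩

/-- The Lie derivative along `h(u)` on vertical `s`-forms:
`(L_{h(u)} η)(w_1, …, w_s) = h(u)(η(w_1, …, w_s)) - ∑_j η(w_1, …, [h(u), w_j], …, w_s)`. -/
def lieDeriv (s : ℕ) (u : VField F B) : Module.End ℝ ((Fin s → Ver p) → Fn E M) where
  toFun η w := h.lift u (η w) - ∑ j, η (Function.update w j (h.lieVer u (w j)))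
  map_add' η ζ := by
    funext w
    simp only [Pi.add_apply, map_add, Finset.sum_add_distrib]
    abel
  map_smul' c η := by
    funext w
    simp only [Pi.smul_apply, Derivation.map_smul, RingHom.id_apply, smul_sub, Finset.smul_sum]

end EhresmannConnection

/-- The operator `d^V : Ω^{r,s} → Ω^{r,s+1}`, which is `(-1)^r` times the vertical de Rham
differential of the values. -/
def dV (p : C^∞⟮𝓘(ℝ, E), M; 𝓘(ℝ, F), B⟯) (r s : ℕ) : Cochain p r s →ₗ[ℝ] Cochain p r (s + 1) where
  toFun Θ v := (-1 : ℝ) ^ r •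
    koszul (fun X : Ver p => ((X : VField E M) : Fn E M →ₗ[ℝ] Fn E M)) s (Θ v)
  map_add' Θ Θ' := by funext v; simp only [Pi.add_apply, map_add, smul_add]
  map_smul' c Θ := by
    funext v; simp only [Pi.smul_apply, map_smul, RingHom.id_apply]; exact smul_comm _ _ _

namespace EhresmannConnection

variable {p : C^∞⟮𝓘(ℝ, E), M; 𝓘(ℝ, F), B⟯} (h : EhresmannConnection p)

/-- The covariant derivative `d^H : Ω^{r,s} → Ω^{r+1,s}` of the connection. -/
def dH (r s : ℕ) : Cochain p r s →ₗ[ℝ] Cochain p (r + 1) s :=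
  koszul (h.lieDeriv s) r

/-- The operator `d^C : Ω^{r,s+1} → Ω^{r+2,s}`, the antisymmetrized contraction with the curvature,
`(d^C Θ)(v_0, …, v_{r+1}) = (-1)^r ∑_{i < j} (-1)^(i+j) i_{C(v_i, v_j)} Θ(…, v̂_i, …, v̂_j, …)`. -/
def dC {r s : ℕ} (Θ : Cochain p r (s + 1)) : Cochain p (r + 2) s := fun v w =>
  (-1 : ℝ) ^ r • ∑ j : Fin (r + 2), ∑ i : Fin (r + 1),
    if i.castSucc < j then
      (-1 : ℝ) ^ ((i : ℕ) + (j : ℕ)) •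
        Θ (fun l => v (j.succAbove (i.succAbove l)))
          (Fin.cons (h.curvature (v i.castSucc) (v j)) w)
    else 0

/-- The `(r, s)`-component of a form on `M`:
`Φ^{(r,s)}(v_1, …, v_r)(w_1, …, w_s) = Φ(h(v_1), …, h(v_r), w_1, …, w_s)`. -/
def component {r s : ℕ} (Φ : Form E M (r + s)) : Cochain p r s := fun v w =>
  Φ (Fin.append (fun i => h.lift (v i)) fun j => (w j : VField E M))

/-- A connection compatible with a vertical `3`-form: `d^H Φ_V = 0`. -/
def IsCompatible (ΦV : VForm p 3) : Prop := h.dH 0 3 ΦV.toCochain = 0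

/-- The subspace `d^H {y ∈ Ω^{r,s+1} | d^V y = 0} + d^V Ω^{r+1,s}` of elements that represent zero
in `E_2^{r+1,s+1} = H^{r+1}(B, H^{s+1}(Ver))`. -/
def boundaries₂ (r s : ℕ) : Submodule ℝ (Cochain p (r + 1) (s + 1)) :=
  (mixedForms p r (s + 1) ⊓ LinearMap.ker (dV p r (s + 1))).map (h.dH r (s + 1)) ⊔
    (mixedForms p (r + 1) s).map (dV p (r + 1) s)

/-- The class `[x]_2` modulo `boundaries₂`; on the cocycles of the second page of the Leray-Serre
spectral sequence it is the class in `E_2^{r+1,s+1} = H^{r+1}(B, H^{s+1}(Ver))`. -/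
def class₂ (r s : ℕ) (x : Cochain p (r + 1) (s + 1)) :
    Cochain p (r + 1) (s + 1) ⧸ h.boundaries₂ r s :=
  (h.boundaries₂ r s).mkQ x

end EhresmannConnection

/-- The subspace `d^V Ω^{r,s}`. -/
def boundaries₁ (p : C^∞⟮𝓘(ℝ, E), M; 𝓘(ℝ, F), B⟯) (r s : ℕ) : Submodule ℝ (Cochain p r (s + 1)) :=
  (mixedForms p r s).map (dV p r s)

/-- The class `[x]_1` modulo `d^V Ω^{r,s}`; on elements of `Ω^{r,s+1}` with `d^V x = 0` it is the
class in `E_1^{r,s+1} = Ω^r(B, H^{s+1}(Ver))`. -/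
def class₁ (p : C^∞⟮𝓘(ℝ, E), M; 𝓘(ℝ, F), B⟯) (r s : ℕ) (x : Cochain p r (s + 1)) :
    Cochain p r (s + 1) ⧸ boundaries₁ p r s :=
  (boundaries₁ p r s).mkQ x

/-- A fibration: a smooth submersion that admits a complete Ehresmann connection. -/
structure IsFibration (p : C^∞⟮𝓘(ℝ, E), M; 𝓘(ℝ, F), B⟯) : Prop where
  submersion : Manifold.IsSubmersion 𝓘(ℝ, E) 𝓘(ℝ, F) ∞ p
  complete : ∃ h : EhresmannConnection p, h.IsComplete

/-- A 2-plectic fibration: a fibration with a vertically closed vertical `3`-form that is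
nondegenerate at every point and admits a compatible connection. -/
structure IsTwoPlecticFibration (p : C^∞⟮𝓘(ℝ, E), M; 𝓘(ℝ, F), B⟯) (ΦV : VForm p 3) : Prop where
  fibration : IsFibration p
  closed : dV p 0 3 ΦV.toCochain = 0
  nondegenerate : ∀ (m : M) (X : Ver p), (∀ Y Z : Ver p, ΦV ![X, Y, Z] m = 0) →
    ∀ f : Fn E M, (X : VField E M) f m = 0
  compatible : ∃ h : EhresmannConnection p, h.IsCompatible ΦV

/-- `Φ` is an extension of `Φ_V`: its restriction to the fibres is `Φ_V`. -/
def IsExtension {p : C^∞⟮𝓘(ℝ, E), M; 𝓘(ℝ, F), B⟯} {k : ℕ} (ΦV : VForm p k) (Φ : Form E M k) : Prop :=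
  ∀ w : Fin k → Ver p, Φ (fun i => (w i : VField E M)) = ΦV w

end Fibration

end TwoPlectic

end

/-!
The total differential of a form `Φ` with components `Φ_V`, `α_H`, `ω_H`, `Φ_H` is computed by the
Koszul formula: its components are `d^V Φ_V`, `d^H Φ_V + d^V α_H`, `d^C Φ_V + d^H α_H + d^V ω_H`,
`d^C α_H + d^H ω_H + d^V Φ_H` and `d^H Φ_H + d^C ω_H` (the lemmas `HasComponents.extD_04` to
`HasComponents.extD_40`). Every choice of components comes from a form on `M`
(`exists_hasComponents`): over a small open set of `B`, a frame of vector fields splits the vector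
fields on `M` into horizontal and vertical parts, which gives a form there, and a partition of unity
on `B` glues the local forms. Conversely a form on `M` is determined by its values on horizontal
lifts and vertical fields (`form_eq_zero_of_components`).

The vanishing of the first two obstructions provides solutions of the equations in degrees `(2,2)`
and `(3,1)`, so the four components of `dΦ` other than the purely horizontal one vanish, that is,
`Ξ = dΦ` is killed by contraction with vertical fields. As `dΞ = 0` (`koszul_koszul`), Cartan's
formula shows that the Lie derivatives of `Ξ` along vertical fields vanish. Hence the values of `Ξ`
on horizontal lifts are annihilated by vertical fields, and since `p` is a submersion with connected
fibres they are pull-backs of smooth functions on `B` (`exists_comp_eq_of_ver_eq_zero`). Thus `Ξ` is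
the pull-back of a closed form `φ` on `B` (`existsUnique_pullbackForm_eq`).

If `φ = dη`, subtracting `p^* η` from `Φ_H` changes only the purely horizontal component of `dΦ` and
makes it vanish. In the other direction, the horizontal components `Φ_H` and `Φ_H'` of two forms
that agree in the other components and satisfy the equation in degree `(3,1)` differ by a
`d^V`-closed element of `Ω^{3,0}`, that is, by some `p^* η`; if the second form is closed, then
`p^* φ = d^H (Φ_H - Φ_H') = p^* dη`.
-/

noncomputable section

namespace TwoPlectic

/-! ### Cartan calculus for the Koszul differential -/

section Cochains

variable {L A : Type*}

/-- The contraction `i_x c` of a cochain, in its first argument. -/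
def contr {k : ℕ} (x : L) (c : (Fin (k + 1) → L) → A) : (Fin k → L) → A :=
  fun y => c (Fin.cons x y)

lemma ext_contr {k : ℕ} {c c' : (Fin (k + 1) → L) → A} (h : ∀ x, contr x c = contr x c') :
    c = c' := by
  funext v
  rw [← Fin.cons_self_tail v]
  exact congrFun (h (v 0)) (Fin.tail v)

lemma contr_sub_cochain [AddCommGroup A] {k : ℕ} (x : L) (c c' : (Fin (k + 1) → L) → A) :
    contr x (c - c') = contr x c - contr x c' := rfl

section Alt

variable (R : Type*) [CommRing R] [AddCommGroup L] [Module R L] [AddCommGroup A] [Module R A]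

/-- A cochain is an alternating form over `R` if it is the underlying function of an alternating
`R`-multilinear map. -/
def IsAlt {k : ℕ} (c : (Fin k → L) → A) : Prop := ∃ η : L [⋀^Fin k]→ₗ[R] A, ⇑η = c

variable {R}

lemma isAlt_zero_arg (c : (Fin 0 → L) → A) : IsAlt R c := by
  refine ⟨AlternatingMap.constOfIsEmpty R L (Fin 0) (c Fin.elim0), ?_⟩
  funext v
  simp only [AlternatingMap.constOfIsEmpty_apply, Function.const_apply]
  exact congrArg c (Subsingleton.elim _ _)

/-- A cochain is alternating and multilinear as soon as this holds for its contractions, which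
depend linearly on the vector, and it vanishes when its first two arguments agree. -/
lemma isAlt_of_contr {k : ℕ} {c : (Fin (k + 1) → L) → A}
    (hadd : ∀ x y, contr (x + y) c = contr x c + contr y c)
    (hsmul : ∀ (r : R) x, contr (r • x) c = r • contr x c)
    (hcontr : ∀ x, IsAlt R (contr x c))
    (hzero : ∀ x (v : Fin k → L) (j : Fin k), (j : ℕ) = 0 → v j = x → c (Fin.cons x v) = 0) :
    IsAlt R c := by
  choose η hη using hcontr
  have hη' : ∀ x v, η x v = c (Fin.cons x v) := fun x v => congrFun (hη x) v
  let m : L →ₗ[R] MultilinearMap R (fun _ : Fin k => L) A :=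
    { toFun := fun x => (η x).toMultilinearMap
      map_add' := fun x y => by
        ext v
        have := congrFun (hadd x y) v
        simpa [hη', contr] using this
      map_smul' := fun r x => by
        ext v
        have := congrFun (hsmul r x) v
        simpa [hη', contr] using this }
  let f : MultilinearMap R (fun _ : Fin (k + 1) => L) A := LinearMap.uncurryLeft m
  have hf : ∀ v, f v = c v := fun v => by
    change η (v 0) (Fin.tail v) = c v
    rw [hη', Fin.cons_self_tail]
  -- the first argument equals a later one
  have key : ∀ (v : Fin (k + 1) → L) (j : Fin k), v 0 = v j.succ → f v = 0 := by
    intro v j hj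
    cases k with
    | zero => exact j.elim0
    | succ k =>
      have hz : ∀ v : Fin (k + 2) → L, v 0 = v 1 → f v = 0 := fun v h01 => by
        rw [hf, ← Fin.cons_self_tail v]
        exact hzero _ _ 0 rfl h01.symm
      by_cases hj0 : j = 0
      · subst hj0
        exact hz v hj
      -- exchange the first two arguments, using the values on `x, x` for `x = v 0 + v 1`
      have hswap : ∀ x y (u : Fin k → L),
          f (Fin.cons x (Fin.cons y u)) + f (Fin.cons y (Fin.cons x u)) = 0 := by
        intro x y u
        have h0 := hz (Fin.cons (x + y) (Fin.cons (x + y) u)) rfl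
        rw [MultilinearMap.cons_add] at h0
        have e : ∀ z, f (Fin.cons z (Fin.cons (x + y) u)) =
            f (Fin.cons z (Fin.cons x u)) + f (Fin.cons z (Fin.cons y u)) := by
          intro z
          have := MultilinearMap.cons_add (m z) u x y
          exact this
        rw [e, e, hz (Fin.cons x (Fin.cons x u)) rfl, hz (Fin.cons y (Fin.cons y u)) rfl] at h0
        simpa using h0
      have hv : v = Fin.cons (v 0) (Fin.cons (v 1) (Fin.tail (Fin.tail v))) := by
        conv_lhs => rw [← Fin.cons_self_tail v, ← Fin.cons_self_tail (Fin.tail v)]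
        rfl
      have h1 := hswap (v 0) (v 1) (Fin.tail (Fin.tail v))
      rw [← hv] at h1
      rw [eq_neg_of_add_eq_zero_left h1, neg_eq_zero]
      change η (v 1) _ = 0
      obtain ⟨i, rfl⟩ := Fin.exists_succ_eq.2 hj0
      exact (η (v 1)).map_eq_zero_of_eq _ (i := 0) (j := i.succ) hj (Fin.succ_ne_zero i).symm
  refine ⟨{ f with map_eq_zero_of_eq' := ?_ }, funext hf⟩
  intro v i j hv hij
  change f v = 0
  induction i using Fin.cases with
  | zero =>
    obtain ⟨j, rfl⟩ := Fin.exists_succ_eq.2 (Ne.symm hij)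
    exact key v j hv
  | succ i =>
    induction j using Fin.cases with
    | zero => exact key v i hv.symm
    | succ j =>
      change η (v 0) (Fin.tail v) = 0
      exact (η (v 0)).map_eq_zero_of_eq _ (i := i) (j := j) hv fun h => hij (by rw [h])

namespace IsAlt

variable {k : ℕ}

lemma contraction {c : (Fin (k + 1) → L) → A} (hc : IsAlt R c) (x : L) :
    IsAlt R (contr x c) := by
  obtain ⟨η, rfl⟩ := hc
  exact ⟨η.curryLeft x, rfl⟩

lemma contr_add {c : (Fin (k + 1) → L) → A} (hc : IsAlt R c) (x y : L) :
    contr (x + y) c = contr x c + contr y c := by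
  obtain ⟨η, rfl⟩ := hc
  funext v
  exact η.toMultilinearMap.cons_add v x y

lemma contr_smul {c : (Fin (k + 1) → L) → A} (hc : IsAlt R c) (r : R) (x : L) :
    contr (r • x) c = r • contr x c := by
  obtain ⟨η, rfl⟩ := hc
  funext v
  exact η.toMultilinearMap.cons_smul v r x

lemma contr_neg {c : (Fin (k + 1) → L) → A} (hc : IsAlt R c) (x : L) :
    contr (-x) c = -contr x c := by
  rw [← neg_one_smul R x, hc.contr_smul, neg_one_smul]

lemma contr_sub {c : (Fin (k + 1) → L) → A} (hc : IsAlt R c) (x y : L) :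
    contr (x - y) c = contr x c - contr y c := by
  rw [sub_eq_add_neg, hc.contr_add, hc.contr_neg, sub_eq_add_neg]

lemma contr_swap {c : (Fin (k + 2) → L) → A} (hc : IsAlt R c) (x y : L) :
    contr y (contr x c) = -contr x (contr y c) := by
  obtain ⟨η, rfl⟩ := hc
  funext v
  have h := η.map_swap (Fin.cons y (Fin.cons x v)) (i := 0) (j := 1) (by simp)
  rw [Pi.neg_apply]
  refine Eq.trans (congrArg η ?_) h
  funext i
  refine Fin.cases ?_ (fun i => ?_) i
  · simp
  · refine Fin.cases ?_ (fun i => ?_) i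
    · simp
    · have h2 : Equiv.swap (0 : Fin (k + 2)) 1 i.succ.succ = i.succ.succ :=
        Equiv.swap_apply_of_ne_of_ne (Fin.succ_ne_zero _)
          (by rw [← Fin.succ_zero_eq_one, Ne, Fin.succ_inj]; exact Fin.succ_ne_zero _)
      simp [h2]

lemma contr_contr_self {c : (Fin (k + 2) → L) → A} (hc : IsAlt R c) (x : L) :
    contr x (contr x c) = 0 := by
  obtain ⟨η, rfl⟩ := hc
  funext v
  exact η.map_eq_zero_of_eq _ (i := 0) (j := 1) rfl (by simp)

/-- Moving an argument from the first place to the place `j`. -/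
lemma cons_succAbove {c : (Fin (k + 1) → L) → A} (hc : IsAlt R c) (j : Fin (k + 1)) (x : L)
    (y : Fin (k + 1) → L) :
    c (Function.update y j x) = (-1 : ℤ) ^ (j : ℕ) • c (Fin.cons x fun l => y (j.succAbove l)) := by
  obtain ⟨η, rfl⟩ := hc
  have h := η.map_insertNth j x (j.removeNth y)
  rw [Fin.insertNth_removeNth] at h
  rw [h]
  rcases Nat.even_or_odd (j : ℕ) with hj | hj <;> simp [hj.neg_one_pow] <;> rfl

lemma sub {c c' : (Fin k → L) → A} (hc : IsAlt R c) (hc' : IsAlt R c') : IsAlt R (c - c') := by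
  obtain ⟨η, rfl⟩ := hc
  obtain ⟨ζ, rfl⟩ := hc'
  exact ⟨η - ζ, rfl⟩

end IsAlt

end Alt

lemma koszul_zero_apply [Bracket L L] [AddCommGroup A] [Module ℝ A]
    (ρ : L → Module.End ℝ A) (c : (Fin 0 → L) → A) (y : Fin 1 → L) :
    koszul ρ 0 c y = ρ (y 0) (c Fin.elim0) := by
  change koszulAction ρ c y + koszulBracket c y = _
  rw [koszulAction, Fin.sum_univ_succ, Finset.univ_eq_empty, Finset.sum_empty, koszulBracket]
  simp only [Fin.val_zero, pow_zero, one_smul, add_zero]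
  exact congrArg _ (congrArg c (Subsingleton.elim _ _))

section Lie

variable [LieRing L] [AddCommGroup A] [Module ℝ A] (ρ : L → Module.End ℝ A)

/-- The Lie derivative of a cochain. -/
def lieD {k : ℕ} (x : L) (c : (Fin k → L) → A) : (Fin k → L) → A :=
  fun y => ρ x (c y) - ∑ j, c (Function.update y j ⁅x, y j⁆)

lemma lieD_sub {k : ℕ} (x : L) (c c' : (Fin k → L) → A) :
    lieD ρ x (c - c') = lieD ρ x c - lieD ρ x c' := by
  funext y
  simp only [lieD, Pi.sub_apply, map_sub, Finset.sum_sub_distrib]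
  abel

lemma lieD_add {k : ℕ} (x : L) (c c' : (Fin k → L) → A) :
    lieD ρ x (c + c') = lieD ρ x c + lieD ρ x c' := by
  funext y
  simp only [lieD, Pi.add_apply, map_add, Finset.sum_add_distrib]
  abel

lemma contr_lieD {k : ℕ} (x y : L) (c : (Fin (k + 1) → L) → A) :
    contr y (lieD ρ x c) = lieD ρ x (contr y c) - contr ⁅x, y⁆ c := by
  funext v
  simp only [contr, lieD, Pi.sub_apply, Fin.sum_univ_succ, Fin.cons_zero, Fin.cons_succ,
    Fin.update_cons_zero, Fin.cons_update]
  abel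

/-- Cartan's formula `i_x d = L_x - d i_x`. -/
lemma contr_koszul {R : Type*} [CommRing R] [Module R L] [Module R A] {k : ℕ} (x : L)
    {c : (Fin (k + 1) → L) → A} (hc : IsAlt R c) :
    contr x (koszul ρ (k + 1) c) = lieD ρ x c - koszul ρ k (contr x c) := by
  funext y
  have hA : koszulAction ρ c (Fin.cons x y) = ρ x (c y) - koszulAction ρ (contr x c) y := by
    rw [koszulAction, Fin.sum_univ_succ, koszulAction, sub_eq_add_neg, ← Finset.sum_neg_distrib]
    congr 1
    · simp
    · refine Finset.sum_congr rfl fun i _ => ?_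
      rw [← neg_smul]
      congr 1
      · simp [pow_succ]
      · simp only [Fin.cons_succ, contr]
        congr 2
        funext l
        refine Fin.cases ?_ (fun l => ?_) l <;> simp
  have hB : koszulBracket c (Fin.cons x y) =
      -(∑ j, c (Function.update y j ⁅x, y j⁆)) - koszulBracket (contr x c) y := by
    have hj : ∀ j : Fin (k + 1), (∑ i : Fin (k + 1), if i.castSucc < j.succ then
        (-1 : ℝ) ^ ((i : ℕ) + (j.succ : ℕ)) •
          c (Fin.cons ⁅(Fin.cons x y : Fin (k + 2) → L) i.castSucc,
            (Fin.cons x y : Fin (k + 2) → L) j.succ⁆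
            fun l => (Fin.cons x y : Fin (k + 2) → L) (j.succ.succAbove (i.succAbove l)))
        else 0) = -c (Function.update y j ⁅x, y j⁆) +
          ∑ i : Fin k, if i.succ.castSucc < j.succ then
        (-1 : ℝ) ^ ((i.succ : ℕ) + (j.succ : ℕ)) •
          c (Fin.cons ⁅(Fin.cons x y : Fin (k + 2) → L) i.succ.castSucc,
            (Fin.cons x y : Fin (k + 2) → L) j.succ⁆
            fun l => (Fin.cons x y : Fin (k + 2) → L) (j.succ.succAbove (i.succ.succAbove l)))
        else 0 := by
      intro j
      rw [Fin.sum_univ_succ]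
      congr 1
      rw [if_pos (by simp [Fin.lt_def]), hc.cons_succAbove j]
      have : (fun l => (Fin.cons x y : Fin (k + 2) → L)
          (j.succ.succAbove ((0 : Fin (k + 1)).succAbove l))) = fun l => y (j.succAbove l) := by
        funext l
        simp
      rw [this]
      rcases Nat.even_or_odd (j : ℕ) with hj | hj <;>
        simp [pow_succ, hj.neg_one_pow]
    rw [koszulBracket, Fin.sum_univ_succ]
    simp only [Fin.not_lt_zero, if_false, Finset.sum_const_zero, zero_add]
    rw [Finset.sum_congr rfl fun j _ => hj j, Finset.sum_add_distrib, Finset.sum_neg_distrib,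
      sub_eq_add_neg]
    congr 1
    cases k with
    | zero => simp [koszulBracket]
    | succ k =>
      rw [koszulBracket, ← Finset.sum_neg_distrib]
      refine Finset.sum_congr rfl fun j _ => ?_
      rw [← Finset.sum_neg_distrib]
      refine Finset.sum_congr rfl fun i _ => ?_
      have hlt : i.succ.castSucc < j.succ ↔ i.castSucc < j := by simp [Fin.lt_def]
      by_cases h : i.castSucc < j
      · rw [if_pos h, if_pos (hlt.2 h)]
        have hsgn : ((-1 : ℝ) ^ ((i.succ : ℕ) + (j.succ : ℕ))) = (-1) ^ ((i : ℕ) + (j : ℕ)) := by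
          simp only [Fin.val_succ]
          ring
        rw [hsgn, ← smul_neg]
        congr 1
        have hsw := congrFun (hc.contr_swap x ⁅y i.castSucc, y j⁆)
          (fun l => y (j.succAbove (i.succAbove l)))
        simp only [contr, Pi.neg_apply] at hsw ⊢
        rw [hsw, neg_neg]
        congr 1
        funext l
        refine Fin.cases ?_ (fun l => ?_) l
        · simp only [Fin.cons_zero, ← Fin.succ_castSucc, Fin.cons_succ]
        · refine Fin.cases ?_ (fun l => ?_) l <;> simp
      · rw [if_neg h, if_neg fun h' => h (hlt.1 h'), neg_zero]
  change koszulAction ρ c (Fin.cons x y) + koszulBracket c (Fin.cons x y) = _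
  rw [hA, hB]
  change _ = ρ x (c y) - _ - (koszulAction ρ (contr x c) y + koszulBracket (contr x c) y)
  abel

lemma lieD_zero_apply (x : L) (c : (Fin 0 → L) → A) (y : Fin 0 → L) :
    lieD ρ x c y = ρ x (c y) := by
  simp [lieD]

end Lie

end Cochains

/-! ### The exterior derivative on derivations of a commutative algebra -/

section Derivations

variable {R : Type*} [CommRing R] [Algebra ℝ R]

local notation "𝔇" => Derivation ℝ R R

/-- The action of derivations on the algebra. -/
abbrev derAct (X : Derivation ℝ R R) : Module.End ℝ R := (X : R →ₗ[ℝ] R)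

lemma lie_smul_der (X Y : 𝔇) (f : R) : ⁅X, f • Y⁆ = f • ⁅X, Y⁆ + X f • Y := by
  ext g
  simp only [Derivation.commutator_apply, Derivation.smul_apply, Derivation.add_apply,
    smul_eq_mul, Derivation.leibniz]
  ring

lemma smul_lie_der (X Y : 𝔇) (f : R) : ⁅f • X, Y⁆ = f • ⁅X, Y⁆ - Y f • X := by
  ext g
  simp only [Derivation.commutator_apply, Derivation.smul_apply, Derivation.sub_apply,
    smul_eq_mul, Derivation.leibniz]
  ring

lemma lieD_smul_cochain {k : ℕ} (X : 𝔇) (f : R) (c : (Fin k → 𝔇) → R) :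
    lieD derAct X (f • c) = f • lieD derAct X c + X f • c := by
  funext y
  simp only [lieD, Pi.smul_apply, Pi.add_apply, smul_eq_mul, ← Finset.mul_sum]
  change X (f * _) - _ = f * (X _ - _) + _
  rw [Derivation.leibniz]
  simp only [smul_eq_mul]
  ring

lemma lieD_add_vec {k : ℕ} (X Y : 𝔇) {c : (Fin k → 𝔇) → R} (hc : IsAlt R c) :
    lieD derAct (X + Y) c = lieD derAct X c + lieD derAct Y c := by
  obtain ⟨η, rfl⟩ := hc
  funext y
  simp only [lieD, Pi.add_apply, add_lie, AlternatingMap.map_update_add, Finset.sum_add_distrib]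
  change X _ + Y _ - _ = X _ - _ + (Y _ - _)
  abel

lemma lieD_smul_vec {k : ℕ} (X : 𝔇) (f : R) {c : (Fin k → 𝔇) → R} (hc : IsAlt R c)
    (y : Fin k → 𝔇) :
    lieD derAct (f • X) c y =
      f * lieD derAct X c y + ∑ j, y j f * c (Function.update y j X) := by
  obtain ⟨η, rfl⟩ := hc
  simp only [lieD, smul_lie_der, AlternatingMap.map_update_sub, AlternatingMap.map_update_smul,
    Finset.sum_sub_distrib, smul_eq_mul, ← Finset.mul_sum]
  change f * X _ - _ = f * (X _ - _) + _
  ring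

lemma koszul_smul_cochain {k : ℕ} (f : R) (c : (Fin k → 𝔇) → R) (y : Fin (k + 1) → 𝔇) :
    koszul derAct k (f • c) y = f * koszul derAct k c y +
      ∑ j : Fin (k + 1), (-1 : ℝ) ^ (j : ℕ) • (y j f * c fun l => y (j.succAbove l)) := by
  change koszulAction _ _ _ + koszulBracket _ _ = f * (koszulAction _ _ _ + koszulBracket _ _) + _
  have hA : koszulAction derAct (f • c) y = f * koszulAction derAct c y +
      ∑ j : Fin (k + 1), (-1 : ℝ) ^ (j : ℕ) • (y j f * c fun l => y (j.succAbove l)) := by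
    rw [koszulAction, koszulAction, Finset.mul_sum, ← Finset.sum_add_distrib]
    refine Finset.sum_congr rfl fun j _ => ?_
    rw [mul_smul_comm, ← smul_add]
    congr 1
    change y j (f * _) = f * y j _ + _
    rw [Derivation.leibniz]
    simp only [smul_eq_mul]
    ring
  have hB : koszulBracket (f • c) y = f * koszulBracket c y := by
    cases k with
    | zero => simp [koszulBracket]
    | succ k =>
      simp only [koszulBracket, Finset.mul_sum]
      refine Finset.sum_congr rfl fun j _ => Finset.sum_congr rfl fun i _ => ?_
      split_ifs <;> simp
  rw [hA, hB]
  ring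

lemma IsAlt.lieDerivative {k : ℕ} (X : 𝔇) {c : (Fin k → 𝔇) → R} (hc : IsAlt R c) :
    IsAlt R (lieD derAct X c) := by
  induction k with
  | zero => exact isAlt_zero_arg _
  | succ k ih =>
    refine isAlt_of_contr (fun Y Z => ?_) (fun f Y => ?_) (fun Y => ?_) ?_
    · rw [contr_lieD, contr_lieD, contr_lieD, hc.contr_add, lie_add, hc.contr_add, lieD_add]
      abel
    · rw [contr_lieD, contr_lieD, hc.contr_smul, lie_smul_der, hc.contr_add, hc.contr_smul,
        hc.contr_smul, lieD_smul_cochain, smul_sub]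
      abel
    · rw [contr_lieD]
      exact (ih (hc.contraction Y)).sub (hc.contraction _)
    · intro Y v j hj hv
      cases k with
      | zero => exact j.elim0
      | succ k =>
        obtain rfl : j = 0 := Fin.ext hj
        have h : contr Y (contr Y (lieD derAct X c)) = 0 := by
          rw [contr_lieD]
          change contr Y (lieD derAct X (contr Y c)) - contr Y (contr _ c) = 0
          rw [contr_lieD, hc.contr_contr_self, hc.contr_swap ⁅X, Y⁆ Y]
          have : lieD derAct X (0 : (Fin k → 𝔇) → R) = 0 := by
            funext y; simp [lieD]
          rw [this]
          abel
        have h2 := congrFun h (Fin.tail v)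
        simp only [contr] at h2
        rwa [← hv, Fin.cons_self_tail, hv] at h2

/-- The exterior derivative of an alternating form is an alternating form. -/
lemma IsAlt.extDerivative {k : ℕ} {c : (Fin k → 𝔇) → R} (hc : IsAlt R c) :
    IsAlt R (koszul derAct k c) := by
  induction k with
  | zero =>
    have h : ∀ X : 𝔇, contr X (koszul derAct 0 c) = fun _ => X (c Fin.elim0) := fun X => by
      funext y
      exact koszul_zero_apply _ _ _
    refine isAlt_of_contr (fun Y Z => ?_) (fun f Y => ?_) (fun Y => isAlt_zero_arg _)
      fun _ _ j => Fin.elim0 j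
    · simp only [h]; rfl
    · simp only [h]; rfl
  | succ k ih =>
    refine isAlt_of_contr (fun Y Z => ?_) (fun f Y => ?_) (fun Y => ?_) ?_
    · rw [contr_koszul _ _ hc, contr_koszul _ _ hc, contr_koszul _ _ hc, hc.contr_add, map_add,
        lieD_add_vec _ _ hc]
      abel
    · rw [contr_koszul _ _ hc, contr_koszul _ _ hc, hc.contr_smul]
      funext y
      rw [Pi.sub_apply, lieD_smul_vec _ _ hc, koszul_smul_cochain]
      have : ∀ j : Fin (k + 1), y j f * c (Function.update y j Y) =
          (-1 : ℝ) ^ (j : ℕ) • (y j f * contr Y c fun l => y (j.succAbove l)) := by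
        intro j
        rw [hc.cons_succAbove j]
        rcases Nat.even_or_odd (j : ℕ) with hj | hj <;> simp [hj.neg_one_pow, contr]
      rw [Finset.sum_congr rfl fun j _ => this j]
      simp only [Pi.smul_apply, Pi.sub_apply, smul_eq_mul]
      ring
    · rw [contr_koszul _ _ hc]
      exact (hc.lieDerivative Y).sub (ih (hc.contraction Y))
    · intro Y v j hj hv
      cases k with
      | zero =>
        obtain rfl : j = 0 := Fin.ext hj
        have h : contr Y (contr Y (koszul derAct _ c)) = 0 := by
          have h0 := hc.contr_smul 0 (0 : 𝔇)
          rw [zero_smul, zero_smul] at h0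
          rw [contr_koszul _ _ hc, contr_sub_cochain, contr_lieD, lie_self, h0]
          funext w
          simp only [Pi.sub_apply, lieD_zero_apply, contr, koszul_zero_apply, Fin.cons_zero,
            Pi.zero_apply, sub_zero]
          exact sub_eq_zero.2 (congrArg _ (congrArg c (congrArg _ (Subsingleton.elim _ _))))
        have h2 := congrFun h (Fin.tail v)
        simp only [contr] at h2
        rwa [← hv, Fin.cons_self_tail, hv] at h2
      | succ k =>
        obtain rfl : j = 0 := Fin.ext hj
        have h : contr Y (contr Y (koszul derAct _ c)) = 0 := by
          rw [contr_koszul _ _ hc]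
          change contr Y (lieD derAct Y c) - contr Y (koszul _ _ (contr Y c)) = 0
          rw [contr_lieD, contr_koszul _ _ (hc.contraction Y), hc.contr_contr_self, lie_self, map_zero]
          have := hc.contr_smul 0 (0 : 𝔇)
          rw [zero_smul, zero_smul] at this
          rw [this]
          abel
        have h2 := congrFun h (Fin.tail v)
        simp only [contr] at h2
        rwa [← hv, Fin.cons_self_tail, hv] at h2

lemma lieD_lie {k : ℕ} (X Y : 𝔇) {c : (Fin k → 𝔇) → R} (hc : IsAlt R c) :
    lieD derAct ⁅X, Y⁆ c = lieD derAct X (lieD derAct Y c) - lieD derAct Y (lieD derAct X c) := by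
  induction k with
  | zero =>
    funext y
    simp only [lieD_zero_apply, Pi.sub_apply]
    exact Derivation.commutator_apply _
  | succ k ih =>
    refine ext_contr fun Z => ?_
    rw [contr_sub_cochain]
    simp only [contr_lieD, lieD_sub, ih (hc.contraction Z)]
    rw [lie_lie, hc.contr_sub]
    abel

lemma lieD_koszul {k : ℕ} (X : 𝔇) {c : (Fin k → 𝔇) → R} (hc : IsAlt R c) :
    lieD derAct X (koszul derAct k c) = koszul derAct k (lieD derAct X c) := by
  induction k with
  | zero =>
    funext y
    rw [lieD, koszul_zero_apply, koszul_zero_apply, Fin.sum_univ_succ, Finset.univ_eq_empty,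
      Finset.sum_empty, koszul_zero_apply, lieD_zero_apply, Function.update_self]
    change X (y 0 _) - (⁅X, y 0⁆ _ + 0) = y 0 (X _)
    rw [Derivation.commutator_apply]
    abel
  | succ k ih =>
    refine ext_contr fun Y => ?_
    rw [contr_lieD, contr_koszul _ _ hc, contr_koszul _ _ hc, contr_koszul _ _ (hc.lieDerivative X),
      contr_lieD, lieD_sub, map_sub, ih (hc.contraction Y), lieD_lie _ _ hc]
    abel

/-- `d² = 0`. -/
lemma koszul_koszul {k : ℕ} {c : (Fin k → 𝔇) → R} (hc : IsAlt R c) :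
    koszul derAct (k + 1) (koszul derAct k c) = 0 := by
  induction k with
  | zero =>
    refine ext_contr fun X => ?_
    rw [contr_koszul _ _ hc.extDerivative, lieD_koszul _ hc]
    change _ = (0 : (Fin 1 → 𝔇) → R)
    rw [← map_sub]
    have : lieD derAct X c - contr X (koszul derAct 0 c) = 0 := by
      funext y
      rw [Pi.sub_apply, contr, koszul_zero_apply, lieD_zero_apply, Pi.zero_apply, sub_eq_zero]
      exact congrArg _ (congrArg c (Subsingleton.elim _ _))
    rw [this, map_zero]
  | succ k ih =>
    refine ext_contr fun X => ?_
    rw [contr_koszul _ _ hc.extDerivative, lieD_koszul _ hc, contr_koszul _ _ hc, map_sub,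
      ih (hc.contraction X)]
    change _ = (0 : (Fin (k + 2) → 𝔇) → R)
    abel

end Derivations

/-! ### The components of the exterior derivative of a `3`-form -/

section Explicit

variable {L A : Type*} [Bracket L L] [AddCommGroup A] [Module ℝ A] (ρ : L → Module.End ℝ A)

lemma koszul_one_apply (c : (Fin 1 → L) → A) (x y : L) :
    koszul ρ 1 c ![x, y] = ρ x (c ![y]) - ρ y (c ![x]) - c ![⁅x, y⁆] := by
  have e1 : (fun l => ![x, y] ((0 : Fin 2).succAbove l)) = ![y] := by
    funext l; fin_cases l; rfl
  have e2 : (fun l => ![x, y] ((1 : Fin 2).succAbove l)) = ![x] := by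
    funext l; fin_cases l; rfl
  have e3 : ∀ (z : L) (f : Fin 0 → L), (Fin.cons z f : Fin 1 → L) = ![z] := by
    intro z f; funext l; fin_cases l; rfl
  change koszulAction ρ c _ + koszulBracket c _ = _
  simp only [koszulAction, koszulBracket, Nat.reduceAdd, Fin.sum_univ_two, Finset.univ_unique,
    Finset.sum_singleton, e1, e2, e3]
  simp
  abel

lemma koszul_two_apply (c : (Fin 2 → L) → A) (x y z : L) :
    koszul ρ 2 c ![x, y, z] = ρ x (c ![y, z]) - ρ y (c ![x, z]) + ρ z (c ![x, y])
      - c ![⁅x, y⁆, z] + c ![⁅x, z⁆, y] - c ![⁅y, z⁆, x] := by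
  have e0 : (fun l => ![x, y, z] ((0 : Fin 3).succAbove l)) = ![y, z] := by
    funext l; fin_cases l <;> rfl
  have e1 : (fun l => ![x, y, z] ((1 : Fin 3).succAbove l)) = ![x, z] := by
    funext l; fin_cases l <;> rfl
  have e2 : (fun l => ![x, y, z] ((2 : Fin 3).succAbove l)) = ![x, y] := by
    funext l; fin_cases l <;> rfl
  have f1 : ∀ t : L, (Fin.cons t fun l => ![x, y, z] ((2 : Fin 3).succAbove
      ((1 : Fin 2).succAbove l)) : Fin 2 → L) = ![t, x] := by
    intro t; funext l; fin_cases l <;> rfl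
  have f2 : ∀ t : L, (Fin.cons t fun l => ![x, y, z] ((2 : Fin 3).succAbove
      ((0 : Fin 2).succAbove l)) : Fin 2 → L) = ![t, y] := by
    intro t; funext l; fin_cases l <;> rfl
  have f3 : ∀ t : L, (Fin.cons t fun l => ![x, y, z] ((1 : Fin 3).succAbove
      ((0 : Fin 2).succAbove l)) : Fin 2 → L) = ![t, z] := by
    intro t; funext l; fin_cases l <;> rfl
  change koszulAction ρ c _ + koszulBracket c _ = _
  simp only [koszulAction, koszulBracket, Nat.reduceAdd, Fin.sum_univ_two, Fin.sum_univ_three, e0, e1, e2, f1, f2, f3]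
  simp [Fin.lt_def, pow_succ]
  abel

lemma koszul_three_apply (c : (Fin 3 → L) → A) (x y z t : L) :
    koszul ρ 3 c ![x, y, z, t] = ρ x (c ![y, z, t]) - ρ y (c ![x, z, t]) + ρ z (c ![x, y, t])
      - ρ t (c ![x, y, z])
      - c ![⁅x, y⁆, z, t] + c ![⁅x, z⁆, y, t] - c ![⁅x, t⁆, y, z] - c ![⁅y, z⁆, x, t]
      + c ![⁅y, t⁆, x, z] - c ![⁅z, t⁆, x, y] := by
  have e0 : (fun l => ![x, y, z, t] ((0 : Fin 4).succAbove l)) = ![y, z, t] := by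
    funext l; fin_cases l <;> rfl
  have e1 : (fun l => ![x, y, z, t] ((1 : Fin 4).succAbove l)) = ![x, z, t] := by
    funext l; fin_cases l <;> rfl
  have e2 : (fun l => ![x, y, z, t] ((2 : Fin 4).succAbove l)) = ![x, y, t] := by
    funext l; fin_cases l <;> rfl
  have e3 : (fun l => ![x, y, z, t] ((3 : Fin 4).succAbove l)) = ![x, y, z] := by
    funext l; fin_cases l <;> rfl
  have f : ∀ (s a b : L) (j : Fin 4) (i : Fin 3),
      (fun l => ![x, y, z, t] (j.succAbove (i.succAbove l))) = ![a, b] →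
      (Fin.cons s fun l => ![x, y, z, t] (j.succAbove (i.succAbove l)) : Fin 3 → L)
        = ![s, a, b] := by
    intro s a b j i h
    rw [h]
    rfl
  have g01 := fun s => f s z t 1 0 (by funext l; fin_cases l <;> rfl)
  have g02 := fun s => f s y t 2 0 (by funext l; fin_cases l <;> rfl)
  have g03 := fun s => f s y z 3 0 (by funext l; fin_cases l <;> rfl)
  have g12 := fun s => f s x t 2 1 (by funext l; fin_cases l <;> rfl)
  have g13 := fun s => f s x z 3 1 (by funext l; fin_cases l <;> rfl)
  have g23 := fun s => f s x y 3 2 (by funext l; fin_cases l <;> rfl)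
  change koszulAction ρ c _ + koszulBracket c _ = _
  simp only [koszulAction, koszulBracket, Nat.reduceAdd, Fin.sum_univ_four, Fin.sum_univ_three, e0, e1, e2, e3,
    g01, g02, g03, g12, g13, g23]
  simp [Fin.lt_def, pow_succ]
  abel

end Explicit

section Alternating

variable {R V N : Type*} [CommRing R] [AddCommGroup V] [Module R V] [AddCommGroup N] [Module R N]

lemma form_swap_01 (Φ : V [⋀^Fin 3]→ₗ[R] N) (x y z : V) : Φ ![y, x, z] = -Φ ![x, y, z] := by
  rw [← Φ.map_swap ![x, y, z] (i := 0) (j := 1) (by decide)]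
  congr 1
  funext i
  fin_cases i <;> rfl

lemma form_swap_12 (Φ : V [⋀^Fin 3]→ₗ[R] N) (x y z : V) : Φ ![x, z, y] = -Φ ![x, y, z] := by
  rw [← Φ.map_swap ![x, y, z] (i := 1) (j := 2) (by decide)]
  congr 1
  funext i
  fin_cases i <;> rfl

lemma form_cycle (Φ : V [⋀^Fin 3]→ₗ[R] N) (x y z : V) : Φ ![z, x, y] = Φ ![x, y, z] := by
  rw [form_swap_01, form_swap_12, neg_neg]

lemma form_add_0 (Φ : V [⋀^Fin 3]→ₗ[R] N) (x x' y z : V) :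
    Φ ![x + x', y, z] = Φ ![x, y, z] + Φ ![x', y, z] :=
  Φ.toMultilinearMap.cons_add ![y, z] x x'

end Alternating

section Components

variable {E F : Type*} [NormedAddCommGroup E] [NormedSpace ℝ E]
  [NormedAddCommGroup F] [NormedSpace ℝ F]
  {M B : Type*} [TopologicalSpace M] [ChartedSpace E M] [TopologicalSpace B] [ChartedSpace F B]
  {p : C^∞⟮𝓘(ℝ, E), M; 𝓘(ℝ, F), B⟯}

variable (h : EhresmannConnection p)

namespace EhresmannConnection

/-- `Φ` has the components `ΦV`, `αH`, `ωH`, `ΦH` with respect to the connection. The arguments are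
written out so that the Koszul formula can be evaluated on explicit tuples. -/
structure HasComponents (Φ : Form E M 3) (ΦV : VForm p 3) (αH : Cochain p 1 2) (ωH : Cochain p 2 1)
    (ΦH : Cochain p 3 0) : Prop where
  comp03 : ∀ w₀ w₁ w₂ : Ver p, Φ ![(w₀ : VField E M), w₁, w₂] = ΦV ![w₀, w₁, w₂]
  comp12 : ∀ (u : VField F B) (w₀ w₁ : Ver p), Φ ![h.lift u, w₀, w₁] = αH ![u] ![w₀, w₁]
  comp21 : ∀ (u v : VField F B) (w : Ver p), Φ ![h.lift u, h.lift v, w] = ωH ![u, v] ![w]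
  comp30 : ∀ u v x : VField F B, Φ ![h.lift u, h.lift v, h.lift x] = ΦH ![u, v, x] ![]

lemma lie_lift_lift (u v : VField F B) :
    ⁅h.lift u, h.lift v⁆ = h.lift ⁅u, v⁆ + (h.curvature u v : VField E M) := by
  change _ = _ + (_ - _)
  abel

lemma lie_lift_ver (u : VField F B) (w : Ver p) :
    ⁅h.lift u, (w : VField E M)⁆ = (h.lieVer u w : VField E M) := rfl

lemma lie_ver_ver (w w' : Ver p) :
    ⁅(w : VField E M), (w' : VField E M)⁆ = ((⁅w, w'⁆ : Ver p) : VField E M) := rfl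

lemma dC_zero_apply {s : ℕ} (Θ : Cochain p 0 (s + 1)) (u v : VField F B) (w : Fin s → Ver p) :
    h.dC Θ ![u, v] w = -Θ ![] (Fin.cons (h.curvature u v) w) := by
  have e : ∀ f : Fin 0 → VField F B, f = ![] := fun f => Subsingleton.elim _ _
  simp only [dC, Nat.reduceAdd, Fin.sum_univ_two, Finset.univ_unique, Finset.sum_singleton, e]
  simp

lemma dC_one_apply {s : ℕ} (Θ : Cochain p 1 (s + 1)) (u v x : VField F B) (w : Fin s → Ver p) :
    h.dC Θ ![u, v, x] w = Θ ![x] (Fin.cons (h.curvature u v) w)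
      - Θ ![v] (Fin.cons (h.curvature u x) w) + Θ ![u] (Fin.cons (h.curvature v x) w) := by
  have g01 : (fun l => ![u, v, x] ((1 : Fin 3).succAbove ((0 : Fin 2).succAbove l))) = ![x] := by
    funext l; fin_cases l; rfl
  have g02 : (fun l => ![u, v, x] ((2 : Fin 3).succAbove ((0 : Fin 2).succAbove l))) = ![v] := by
    funext l; fin_cases l; rfl
  have g12 : (fun l => ![u, v, x] ((2 : Fin 3).succAbove ((1 : Fin 2).succAbove l))) = ![u] := by
    funext l; fin_cases l; rfl
  simp only [dC, Fin.sum_univ_two, Fin.sum_univ_three, Nat.reduceAdd, g01, g02, g12]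
  simp [Fin.lt_def, pow_succ]
  abel

lemma dC_two_apply {s : ℕ} (Θ : Cochain p 2 (s + 1)) (u v x y : VField F B) (w : Fin s → Ver p) :
    h.dC Θ ![u, v, x, y] w = -Θ ![x, y] (Fin.cons (h.curvature u v) w)
      + Θ ![v, y] (Fin.cons (h.curvature u x) w) - Θ ![v, x] (Fin.cons (h.curvature u y) w)
      - Θ ![u, y] (Fin.cons (h.curvature v x) w) + Θ ![u, x] (Fin.cons (h.curvature v y) w)
      - Θ ![u, v] (Fin.cons (h.curvature x y) w) := by
  have f : ∀ (a b : VField F B) (j : Fin 4) (i : Fin 3),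
      ![u, v, x, y] (j.succAbove (i.succAbove 0)) = a →
      ![u, v, x, y] (j.succAbove (i.succAbove 1)) = b →
      (fun l => ![u, v, x, y] (j.succAbove (i.succAbove l))) = ![a, b] := by
    intro a b j i h0 h1
    funext l
    fin_cases l
    · exact h0
    · exact h1
  have g01 := f x y 1 0 rfl rfl
  have g02 := f v y 2 0 rfl rfl
  have g03 := f v x 3 0 rfl rfl
  have g12 := f u y 2 1 rfl rfl
  have g13 := f u x 3 1 rfl rfl
  have g23 := f u v 3 2 rfl rfl
  simp only [dC, Fin.sum_univ_four, Fin.sum_univ_three, Nat.reduceAdd, g01, g02, g03, g12, g13,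
    g23]
  simp [Fin.lt_def, pow_succ]
  abel

lemma lieDeriv_zero_apply (u : VField F B) (η : (Fin 0 → Ver p) → Fn E M) :
    h.lieDeriv 0 u η ![] = h.lift u (η ![]) := by
  simp [lieDeriv]

lemma lieDeriv_one_apply (u : VField F B) (η : (Fin 1 → Ver p) → Fn E M) (w : Ver p) :
    h.lieDeriv 1 u η ![w] = h.lift u (η ![w]) - η ![h.lieVer u w] := by
  have e : Function.update ![w] 0 (h.lieVer u w) = ![h.lieVer u w] := by
    funext l; fin_cases l; rfl
  simp [lieDeriv, e]

lemma lieDeriv_two_apply (u : VField F B) (η : (Fin 2 → Ver p) → Fn E M) (w₀ w₁ : Ver p) :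
    h.lieDeriv 2 u η ![w₀, w₁] =
      h.lift u (η ![w₀, w₁]) - η ![h.lieVer u w₀, w₁] - η ![w₀, h.lieVer u w₁] := by
  have e : Function.update ![w₀, w₁] 0 (h.lieVer u w₀) = ![h.lieVer u w₀, w₁] := by
    funext l; fin_cases l <;> rfl
  have e' : Function.update ![w₀, w₁] 1 (h.lieVer u w₁) = ![w₀, h.lieVer u w₁] := by
    funext l; fin_cases l <;> rfl
  simp [lieDeriv, Fin.sum_univ_two, e, e']
  abel

lemma lieDeriv_three_apply (u : VField F B) (η : (Fin 3 → Ver p) → Fn E M) (w₀ w₁ w₂ : Ver p) :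
    h.lieDeriv 3 u η ![w₀, w₁, w₂] = h.lift u (η ![w₀, w₁, w₂]) - η ![h.lieVer u w₀, w₁, w₂]
      - η ![w₀, h.lieVer u w₁, w₂] - η ![w₀, w₁, h.lieVer u w₂] := by
  have e : Function.update ![w₀, w₁, w₂] 0 (h.lieVer u w₀) = ![h.lieVer u w₀, w₁, w₂] := by
    funext l; fin_cases l <;> rfl
  have e' : Function.update ![w₀, w₁, w₂] 1 (h.lieVer u w₁) = ![w₀, h.lieVer u w₁, w₂] := by
    funext l; fin_cases l <;> rfl
  have e'' : Function.update ![w₀, w₁, w₂] 2 (h.lieVer u w₂) = ![w₀, w₁, h.lieVer u w₂] := by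
    funext l; fin_cases l <;> rfl
  simp [lieDeriv, Fin.sum_univ_three, e, e', e'']
  abel

namespace HasComponents

variable {h} {Φ : Form E M 3} {ΦV : VForm p 3} {αH : Cochain p 1 2} {ωH : Cochain p 2 1}
  {ΦH : Cochain p 3 0}

/-- The component of `dΦ` of degree `(0, 4)`; the lemmas below give those of degree `(r, s)` for
`r + s = 4`. In each, brackets of lifts are decomposed into lifts and curvatures, and the vertical
field obtained is moved behind the lifts. -/
lemma extD_04 (H : h.HasComponents Φ ΦV αH ωH ΦH) (w₀ w₁ w₂ w₃ : Ver p) :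
    extD E M 3 Φ ![(w₀ : VField E M), w₁, w₂, w₃] =
      dV p 0 3 ΦV.toCochain ![] ![w₀, w₁, w₂, w₃] := by
  rw [extD, koszul_three_apply]
  simp only [dV, LinearMap.coe_mk, AddHom.coe_mk, pow_zero, one_smul, koszul_three_apply,
    VForm.toCochain, lie_ver_ver, Derivation.coeFn_coe, H.comp03]

lemma extD_13 (H : h.HasComponents Φ ΦV αH ωH ΦH) (u : VField F B) (w₀ w₁ w₂ : Ver p) :
    extD E M 3 Φ ![h.lift u, (w₀ : VField E M), w₁, w₂] =
      (h.dH 0 3 ΦV.toCochain + dV p 1 2 αH) ![u] ![w₀, w₁, w₂] := by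
  rw [extD, koszul_three_apply]
  simp only [Pi.add_apply, dV, dH, LinearMap.coe_mk, AddHom.coe_mk, pow_one, neg_smul, one_smul,
    koszul_two_apply, koszul_zero_apply, Pi.neg_apply, lieDeriv_three_apply, Matrix.cons_val_zero,
    VForm.toCochain, lie_ver_ver, lie_lift_ver, Derivation.coeFn_coe, H.comp03, H.comp12,
    form_swap_01 Φ (h.lift u)]
  rw [show ΦV ![w₀, h.lieVer u w₁, w₂] = Φ ![(w₀ : VField E M), h.lieVer u w₁, w₂] from
      (H.comp03 _ _ _).symm, form_swap_01 Φ (h.lieVer u w₁ : VField E M),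
    show ΦV ![w₀, w₁, h.lieVer u w₂] = Φ ![(w₀ : VField E M), w₁, h.lieVer u w₂] from
      (H.comp03 _ _ _).symm, ← form_cycle Φ (w₀ : VField E M), H.comp03, H.comp03]
  abel

lemma swap_12 (H : h.HasComponents Φ ΦV αH ωH ΦH) (u : VField F B) (w₀ w₁ : Ver p) :
    αH ![u] ![w₁, w₀] = -αH ![u] ![w₀, w₁] := by
  rw [← H.comp12, ← H.comp12, form_swap_12]

lemma extD_22 (H : h.HasComponents Φ ΦV αH ωH ΦH) (u v : VField F B) (w₀ w₁ : Ver p) :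
    extD E M 3 Φ ![h.lift u, h.lift v, (w₀ : VField E M), w₁] =
      (h.dC ΦV.toCochain + h.dH 1 2 αH + dV p 2 1 ωH) ![u, v] ![w₀, w₁] := by
  have hc : ∀ z : Ver p, (Fin.cons z ![w₀, w₁] : Fin 3 → Ver p) = ![z, w₀, w₁] := fun _ => rfl
  rw [extD, koszul_three_apply]
  simp only [Pi.add_apply, dC_zero_apply, hc]
  simp only [dV, dH, LinearMap.coe_mk, AddHom.coe_mk, even_two.neg_one_pow,
    one_smul, koszul_one_apply, Pi.sub_apply, lieDeriv_two_apply,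
    VForm.toCochain, lie_ver_ver, lie_lift_ver, lie_lift_lift, form_add_0,
    form_swap_01 Φ (h.lift v) (h.lieVer u _), form_swap_01 Φ (h.lift u) (h.lieVer v _),
    form_cycle Φ (h.lift u) (h.lift v) (Subtype.val _), Derivation.coeFn_coe, H.comp03, H.comp12,
    H.comp21]
  rw [H.swap_12 v (h.lieVer u w₁) w₀, H.swap_12 u (h.lieVer v w₁) w₀]
  abel

lemma extD_31 (H : h.HasComponents Φ ΦV αH ωH ΦH) (u v x : VField F B) (w : Ver p) :
    extD E M 3 Φ ![h.lift u, h.lift v, h.lift x, (w : VField E M)] =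
      (h.dC αH + h.dH 2 1 ωH + dV p 3 0 ΦH) ![u, v, x] ![w] := by
  have hc : ∀ z : Ver p, (Fin.cons z ![w] : Fin 2 → Ver p) = ![z, w] := fun _ => rfl
  have he : (Fin.elim0 : Fin 0 → Ver p) = ![] := Subsingleton.elim _ _
  rw [extD, koszul_three_apply]
  simp only [Pi.add_apply, dC_one_apply, hc]
  simp only [dV, dH, LinearMap.coe_mk, AddHom.coe_mk, (by decide : Odd 3).neg_one_pow,
    neg_smul, one_smul, koszul_two_apply, Pi.sub_apply, Pi.add_apply, lieDeriv_one_apply,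
    koszul_zero_apply, Matrix.cons_val_zero, he, Pi.neg_apply,
    lie_lift_ver, lie_lift_lift, form_add_0,
    form_swap_01 Φ (h.lift x) (h.curvature u v), form_swap_01 Φ (h.lift v) (h.curvature u x),
    form_swap_01 Φ (h.lift u) (h.curvature v x), form_cycle Φ _ _ (h.lieVer _ _),
    Derivation.coeFn_coe, H.comp12, H.comp21, H.comp30]
  abel

lemma extD_40 (H : h.HasComponents Φ ΦV αH ωH ΦH) (u v x y : VField F B) :
    extD E M 3 Φ ![h.lift u, h.lift v, h.lift x, h.lift y] =
      (h.dH 3 0 ΦH + h.dC ωH) ![u, v, x, y] ![] := by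
  have hc : ∀ z : Ver p, (Fin.cons z ![] : Fin 1 → Ver p) = ![z] := fun _ => rfl
  rw [extD, koszul_three_apply]
  simp only [Pi.add_apply, dC_two_apply, hc]
  simp only [dH, koszul_three_apply, Pi.sub_apply, Pi.add_apply, lieDeriv_zero_apply,
    lie_lift_lift, form_add_0, form_cycle Φ _ _ (h.curvature _ _),
    Derivation.coeFn_coe, H.comp21, H.comp30]
  abel

end HasComponents

end EhresmannConnection

end Components

/-! ### Derivations and smooth functions in charts -/

section Hadamard

open MeasureTheory in
/-- Hadamard's lemma: `G x - G a` is `H x (x - a)` for a smooth family `H` of linear forms. The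
family is the average of the differential of `G` on the segment from `a` to `x`. -/
lemma exists_hadamard {E : Type*} [NormedAddCommGroup E] [NormedSpace ℝ E]
    {G : E → ℝ} (hG : ContDiff ℝ ∞ G) (a : E) :
    ∃ H : E → (E →L[ℝ] ℝ), ContDiff ℝ ∞ H ∧ ∀ x, G x = G a + H x (x - a) := by
  let ψ : ContDiffBump (0 : ℝ) := ⟨2, 3, by norm_num, by norm_num⟩
  have hψ : ∀ t ∈ Set.Icc (0 : ℝ) 1, ψ t = 1 := fun t ht => by
    refine ψ.one_of_mem_closedBall ?_
    rw [Metric.mem_closedBall, Real.dist_eq, sub_zero, abs_of_nonneg ht.1]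
    exact ht.2.trans (by norm_num)
  have hdG : ContDiff ℝ ∞ (fderiv ℝ G) := hG.fderiv_right (by simp)
  -- the cutoff `ψ` gives the integrand compact support in `t`
  let g : E → ℝ → (E →L[ℝ] ℝ) := fun x t => ψ t • fderiv ℝ G (a + t • (x - a))
  have hg : ContDiff ℝ ∞ (Function.uncurry g) := by
    have h1 : ContDiff ℝ ∞ fun q : E × ℝ => ψ q.2 := ψ.contDiff.comp contDiff_snd
    have h2 : ContDiff ℝ ∞ fun q : E × ℝ => fderiv ℝ G (a + q.2 • (q.1 - a)) :=
      hdG.comp (by fun_prop)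
    exact h1.smul h2
  let f : ℝ → ℝ := (Set.Icc (0 : ℝ) 1).indicator fun _ => 1
  have hf : LocallyIntegrable f volume := by
    refine Integrable.locallyIntegrable ?_
    refine (integrable_indicator_iff measurableSet_Icc).2 ?_
    exact integrableOn_const (by simp)
  let H : E → (E →L[ℝ] ℝ) := fun x =>
    MeasureTheory.convolution f (g x) (ContinuousLinearMap.lsmul ℝ ℝ) volume 1
  have hH : ContDiff ℝ ∞ H := by
    rw [← contDiffOn_univ]
    refine contDiffOn_convolution_right_with_param_comp (n := ⊤) (ContinuousLinearMap.lsmul ℝ ℝ)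
      (v := fun _ => (1 : ℝ)) contDiffOn_const isOpen_univ
      (isCompact_closedBall (0 : ℝ) 3) ?_ hf hg.contDiffOn
    intro x t _ ht
    have : ψ t = 0 := ψ.zero_of_le_dist (by
      rw [Metric.mem_closedBall, not_le] at ht
      exact ht.le)
    change ψ t • _ = _
    rw [this, zero_smul]
  refine ⟨H, hH, fun x => ?_⟩
  have hHx : H x = ∫ t in (0 : ℝ)..1, fderiv ℝ G (a + (1 - t) • (x - a)) := by
    change ∫ t, f t • g x (1 - t) = _
    rw [intervalIntegral.integral_of_le zero_le_one, ← integral_Icc_eq_integral_Ioc,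
      ← integral_indicator measurableSet_Icc]
    refine integral_congr_ae (Filter.Eventually.of_forall fun t => ?_)
    by_cases ht : t ∈ Set.Icc (0 : ℝ) 1
    · have : ψ (1 - t) = 1 := hψ _ ⟨by linarith [ht.2], by linarith [ht.1]⟩
      simp [f, g, Set.indicator_of_mem ht, this]
    · simp [f, Set.indicator_of_notMem ht]
  have hcont : Continuous fun t : ℝ => fderiv ℝ G (a + (1 - t) • (x - a)) :=
    hdG.continuous.comp (by fun_prop)
  have hder : ∀ t : ℝ, HasDerivAt (fun t : ℝ => -G (a + (1 - t) • (x - a)))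
      (fderiv ℝ G (a + (1 - t) • (x - a)) (x - a)) t := by
    intro t
    have h1 : HasDerivAt (fun t : ℝ => a + (1 - t) • (x - a)) (-(x - a)) t := by
      have := (((hasDerivAt_id t).const_sub 1).smul_const (x - a)).const_add a
      simpa using this
    have h2 := ((hG.differentiable (by simp)).differentiableAt
      (x := a + (1 - t) • (x - a))).hasFDerivAt.comp_hasDerivAt t h1
    exact h2.neg.congr_deriv (by simp)
  rw [hHx, ContinuousLinearMap.intervalIntegral_apply (hcont.intervalIntegrable _ _),
    intervalIntegral.integral_eq_sub_of_hasDerivAt (fun t _ => hder t)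
      ((hcont.clm_apply continuous_const).intervalIntegrable _ _)]
  simp

end Hadamard

section Charts

variable {E : Type*} [NormedAddCommGroup E] [NormedSpace ℝ E]
  {M : Type*} [TopologicalSpace M] [ChartedSpace E M]

lemma exists_bump [FiniteDimensional ℝ E] [IsManifold 𝓘(ℝ, E) ∞ M] [T2Space M] {x : M} {U : Set M}
    (hU : U ∈ nhds x) :
    ∃ χ : Fn E M, (∀ᶠ y in nhds x, χ y = 1) ∧ tsupport χ ⊆ U ∧ HasCompactSupport χ := by
  obtain ⟨f, -, hf⟩ := (SmoothBumpFunction.nhds_basis_tsupport (I := 𝓘(ℝ, E)) x).mem_iff.1 hU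
  exact ⟨⟨f, f.contMDiff⟩, f.eventuallyEq_one, hf, f.hasCompactSupport⟩

variable {φ : OpenPartialHomeomorph M E} (hφ : φ ∈ IsManifold.maximalAtlas 𝓘(ℝ, E) ∞ M)
include hφ

lemma contDiffOn_comp_symm (f : Fn E M) : ContDiffOn ℝ ∞ (f ∘ φ.symm) φ.target :=
  (f.contMDiff.comp_contMDiffOn (contMDiffOn_symm_of_mem_maximalAtlas hφ)).contDiffOn

lemma differentiableAt_comp_symm (f : Fn E M) {m : M} (hm : m ∈ φ.source) :
    DifferentiableAt ℝ (f ∘ φ.symm) (φ m) :=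
  ((contDiffOn_comp_symm hφ f).contDiffAt
    (φ.open_target.mem_nhds (φ.map_source hm))).differentiableAt (by simp)

/-- A function on the domain of a chart, cut off to a smooth function on the manifold. -/
lemma contMDiff_mul_comp_chart (χ : Fn E M) (hχ : tsupport χ ⊆ φ.source) {g : E → ℝ}
    (hg : ContDiffOn ℝ ∞ g φ.target) :
    ContMDiff 𝓘(ℝ, E) 𝓘(ℝ, ℝ) ∞ fun m => χ m * g (φ m) := by
  refine contMDiff_of_tsupport fun m hm => ?_
  have hm' : m ∈ φ.source := hχ (closure_mono (Function.support_mul_subset_left _ _) hm)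
  refine χ.contMDiff.contMDiffAt.mul ?_
  have h1 : ContMDiffAt 𝓘(ℝ, E) 𝓘(ℝ, ℝ) ∞ g (φ m) :=
    (hg.contDiffAt (φ.open_target.mem_nhds (φ.map_source hm'))).contMDiffAt
  exact h1.comp m (contMDiffAt_of_mem_maximalAtlas hφ hm')

/-- The vector field `χ ∂_e` on a manifold, for a constant vector `e` in a chart and a cutoff
function `χ`. -/
lemma exists_coordDerivation (χ : Fn E M) (hχ : tsupport χ ⊆ φ.source) (e : E) :
    ∃ X : VField E M, ∀ (f : Fn E M) (m : M),
      X f m = χ m * fderiv ℝ (f ∘ φ.symm) (φ m) e := by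
  have hzero : ∀ m ∉ φ.source, χ m = 0 := fun m hm =>
    image_eq_zero_of_notMem_tsupport fun h => hm (hχ h)
  have hsmooth : ∀ f : Fn E M, ContDiffOn ℝ ∞ (fun x => fderiv ℝ (f ∘ φ.symm) x e) φ.target :=
    fun f => ((contDiffOn_comp_symm hφ f).fderiv_of_isOpen φ.open_target (by simp)).clm_apply
      contDiffOn_const
  let T : Fn E M →ₗ[ℝ] Fn E M :=
    { toFun := fun f => ⟨_, contMDiff_mul_comp_chart hφ χ hχ (hsmooth f)⟩
      map_add' := fun f g => by
        ext m
        change χ m * fderiv ℝ ((f ∘ φ.symm) + (g ∘ φ.symm)) (φ m) e = χ m * _ + χ m * _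
        by_cases hm : m ∈ φ.source
        · rw [fderiv_add (differentiableAt_comp_symm hφ f hm) (differentiableAt_comp_symm hφ g hm)]
          simp [mul_add]
        · simp [hzero m hm]
      map_smul' := fun c f => by
        ext m
        change χ m * fderiv ℝ (c • (f ∘ φ.symm)) (φ m) e = c * (χ m * _)
        by_cases hm : m ∈ φ.source
        · rw [fderiv_const_smul (differentiableAt_comp_symm hφ f hm)]
          simp
          ring
        · simp [hzero m hm] }
  refine ⟨Derivation.mk' T fun f g => ?_, fun f m => rfl⟩
  ext m
  change χ m * fderiv ℝ ((f ∘ φ.symm) * (g ∘ φ.symm)) (φ m) e =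
    f m * (χ m * fderiv ℝ (g ∘ φ.symm) (φ m) e) + g m * (χ m * fderiv ℝ (f ∘ φ.symm) (φ m) e)
  by_cases hm : m ∈ φ.source
  · rw [fderiv_mul (differentiableAt_comp_symm hφ f hm) (differentiableAt_comp_symm hφ g hm)]
    simp [φ.left_inv hm]
    ring
  · simp [hzero m hm]

/-- A function with compact support in the domain of a chart is smooth in the chart, when extended
by zero. -/
lemma contDiff_indicator_comp_symm [T2Space M] (k : Fn E M) (hk : HasCompactSupport k)
    (hks : tsupport k ⊆ φ.source) : ContDiff ℝ ∞ (φ.target.indicator (k ∘ φ.symm)) := by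
  rw [contDiff_iff_contDiffAt]
  intro x
  by_cases hx : x ∈ φ.target
  · refine ((contDiffOn_comp_symm hφ k).contDiffAt (φ.open_target.mem_nhds hx)).congr_of_eventuallyEq
      ?_
    filter_upwards [φ.open_target.mem_nhds hx] with y hy
    exact Set.indicator_of_mem hy _
  · have hcl : IsClosed (φ '' tsupport k) :=
      (hk.isCompact.image_of_continuousOn (φ.continuousOn.mono hks)).isClosed
    have hx' : x ∉ φ '' tsupport k := by
      rintro ⟨m, hm, rfl⟩
      exact hx (φ.map_source (hks hm))
    refine (contDiffAt_const (c := (0 : ℝ))).congr_of_eventuallyEq ?_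
    filter_upwards [hcl.isOpen_compl.mem_nhds hx'] with y hy
    by_cases hyt : y ∈ φ.target
    · rw [Set.indicator_of_mem hyt]
      change k (φ.symm y) = 0
      refine image_eq_zero_of_notMem_tsupport fun h => hy ⟨φ.symm y, h, φ.right_inv hyt⟩
    · exact Set.indicator_of_notMem hyt _

/-- A derivation at the point `b` is determined by its values on coordinate functions. -/
lemma pointDerivation_eq_sum [FiniteDimensional ℝ E] [IsManifold 𝓘(ℝ, E) ∞ M] [T2Space M]
    {b : M} (hb : b ∈ φ.source) {ι : Type*} [Fintype ι] (e : Module.Basis ι ℝ E) (x : ι → Fn E M)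
    (hx : ∀ᶠ m in nhds b, ∀ i, x i m = e.coord i (φ m))
    (D : Fn E M →ₗ[ℝ] ℝ) (hD : ∀ f g, D (f * g) = f b * D g + g b * D f) (f : Fn E M) :
    D f = ∑ i, D (x i) * fderiv ℝ (f ∘ φ.symm) (φ b) (e i) := by
  have hD1 : ∀ c : ℝ, D (algebraMap ℝ (Fn E M) c) = 0 := by
    intro c
    have h1 := hD 1 1
    have h2 : (1 : Fn E M) b = 1 := rfl
    rw [mul_one, h2, one_mul] at h1
    rw [Algebra.algebraMap_eq_smul_one, map_smul, show D 1 = 0 by linarith, smul_zero]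
  -- subtracting a constant, the function may be assumed to vanish at `b`
  suffices hsuff : ∀ f : Fn E M, f b = 0 →
      D f = ∑ i, D (x i) * fderiv ℝ (f ∘ φ.symm) (φ b) (e i) by
    have h := hsuff (f - algebraMap ℝ (Fn E M) (f b)) (sub_self (f b))
    rw [map_sub, hD1, sub_zero] at h
    rw [h]
    refine Finset.sum_congr rfl fun i _ => ?_
    congr 2
    change fderiv ℝ (fun y => (f ∘ φ.symm) y - f b) _ = _
    rw [fderiv_sub_const]
  intro f hfb
  obtain ⟨χ, hχ1, hχs, hχc⟩ := exists_bump (E := E) (Filter.inter_mem (φ.open_source.mem_nhds hb) hx)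
  have hχsrc : tsupport χ ⊆ φ.source := fun m hm => (hχs hm).1
  have hχb : χ b = 1 := hχ1.self_of_nhds
  have hts : tsupport (χ * f : Fn E M) ⊆ tsupport χ :=
    closure_mono (Function.support_mul_subset_left _ _)
  have hG := contDiff_indicator_comp_symm hφ (χ * f)
    (hχc.mono (Function.support_mul_subset_left _ _)) (hts.trans hχsrc)
  set G := φ.target.indicator ((χ * f : Fn E M) ∘ φ.symm) with hGdef
  have hGφ : ∀ m ∈ φ.source, G (φ m) = χ m * f m := fun m hm => by
    rw [hGdef, Set.indicator_of_mem (φ.map_source hm), Function.comp_apply, φ.left_inv hm]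
    rfl
  obtain ⟨H, hH, hGH⟩ := exists_hadamard hG (φ b)
  have hGb : G (φ b) = 0 := by rw [hGφ b hb, hfb, mul_zero]
  -- the value of `H` at `b` is the differential of `f`
  have hHb : H (φ b) = fderiv ℝ (f ∘ φ.symm) (φ b) := by
    have h1 : HasFDerivAt G (H (φ b)) (φ b) := by
      have h2 := ((hH.differentiable (by simp)) (φ b)).hasFDerivAt.clm_apply
        ((hasFDerivAt_id (𝕜 := ℝ) (φ b)).sub_const (φ b))
      have h3 := h2.const_add (G (φ b))
      refine (h3.congr_fderiv ?_).congr_of_eventuallyEq (Filter.Eventually.of_forall hGH)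
      ext v
      simp
    have h4 : f ∘ φ.symm =ᶠ[nhds (φ b)] G := by
      have hc := (φ.continuousAt_symm (φ.map_source hb)).eventually
        (p := fun m => χ m = 1) (by rwa [φ.left_inv hb])
      filter_upwards [hc, φ.open_target.mem_nhds (φ.map_source hb)] with y hy hyt
      rw [hGdef, Set.indicator_of_mem hyt]
      change f (φ.symm y) = χ (φ.symm y) * f (φ.symm y)
      rw [hy, one_mul]
    rw [h4.fderiv_eq, h1.fderiv]
  let q : ι → Fn E M := fun i => ⟨_, contMDiff_mul_comp_chart hφ χ hχsrc
    (g := fun y => H y (e i)) (hH.clm_apply contDiff_const).contDiffOn⟩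
  have hid : χ * (χ * f) = ∑ i, q i * (x i - algebraMap ℝ (Fn E M) (x i b)) := by
    ext m
    have hsum : (∑ i, q i * (x i - algebraMap ℝ (Fn E M) (x i b)) : Fn E M) m =
        ∑ i, χ m * H (φ m) (e i) * (x i m - x i b) := by
      have := map_sum (ContMDiffMap.evalRingHom (I := 𝓘(ℝ, E)) (n := ∞) (R := ℝ) m)
        (fun i => q i * (x i - algebraMap ℝ (Fn E M) (x i b))) Finset.univ
      exact this
    rw [hsum]
    change χ m * (χ m * f m) = _
    by_cases hm : m ∈ tsupport χ
    · have hm' := hχs hm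
      have hxb : ∀ i, x i b = e.coord i (φ b) := hx.self_of_nhds
      have hxm : ∀ i, x i m = e.coord i (φ m) := hm'.2
      rw [← hGφ m hm'.1, hGH, hGb, zero_add]
      conv_lhs => rw [← e.sum_repr (φ m - φ b), map_sum, Finset.mul_sum]
      refine Finset.sum_congr rfl fun i _ => ?_
      rw [hxb, hxm, map_smul, ← map_sub, Module.Basis.coord_apply, smul_eq_mul]
      ring
    · have : χ m = 0 := image_eq_zero_of_notMem_tsupport hm
      simp [this]
  have hDid := congrArg D hid
  rw [hD, hD, map_sum] at hDid
  have hfb' : (χ * f : Fn E M) b = 0 := by change χ b * f b = 0; rw [hfb, mul_zero]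
  rw [hfb', hfb, hχb] at hDid
  simp only [one_mul, zero_mul, add_zero] at hDid
  rw [hDid]
  refine Finset.sum_congr rfl fun i _ => ?_
  have h1 : (x i - algebraMap ℝ (Fn E M) (x i b) : Fn E M) b = 0 := sub_self (x i b)
  have h2 : q i b = fderiv ℝ (f ∘ φ.symm) (φ b) (e i) := by
    change χ b * H (φ b) (e i) = _
    rw [hχb, one_mul, hHb]
  rw [hD, h1, h2, map_sub, hD1]
  ring

omit hφ in
/-- Near every point the module of vector fields has a finite dual basis: functions `x i` and
vector fields `∂ i` with `D = ∑ D (x i) ∂ i`, even for derivations `D` at single points. The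
function `χ` restricts this to a neighbourhood of the given point. -/
lemma exists_local_frame [FiniteDimensional ℝ E] [IsManifold 𝓘(ℝ, E) ∞ M] [T2Space M] (b₀ : M) :
    ∃ (χ : Fn E M) (n : ℕ) (x : Fin n → Fn E M) (u : Fin n → VField E M),
      (∀ᶠ b in nhds b₀, χ b = 1) ∧
      ∀ (b : M) (D : Fn E M →ₗ[ℝ] ℝ), (∀ f g, D (f * g) = f b * D g + g b * D f) →
        ∀ f, χ b * (D f - ∑ i, D (x i) * u i f b) = 0 := by
  have hφ := IsManifold.chart_mem_maximalAtlas (I := 𝓘(ℝ, E)) (n := ∞) b₀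
  set φ := chartAt E b₀
  have hb₀ : b₀ ∈ φ.source := mem_chart_source E b₀
  obtain ⟨χ₀, h1, hs, -⟩ := exists_bump (E := E) (φ.open_source.mem_nhds hb₀)
  obtain ⟨V, hV, hVo, hbV⟩ := eventually_nhds_iff.1 h1
  obtain ⟨χ, hχ1, hχs, -⟩ := exists_bump (E := E) (Filter.inter_mem (hVo.mem_nhds hbV)
    (φ.open_source.mem_nhds hb₀))
  let e := Module.finBasis ℝ E
  choose u hu using fun i => exists_coordDerivation hφ χ₀ hs (e i)
  refine ⟨χ, _, fun i => ⟨_, contMDiff_mul_comp_chart hφ χ₀ hs (g := e.coord i)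
    (LinearMap.toContinuousLinearMap (e.coord i)).contDiff.contDiffOn⟩, u, hχ1, ?_⟩
  intro b D hD f
  by_cases hb : b ∈ tsupport χ
  · obtain ⟨hbV, hbs⟩ := hχs hb
    have := pointDerivation_eq_sum hφ hbs e (fun i => ⟨_, contMDiff_mul_comp_chart hφ χ₀ hs
      (g := e.coord i) (LinearMap.toContinuousLinearMap (e.coord i)).contDiff.contDiffOn⟩)
      (by
        filter_upwards [hVo.mem_nhds hbV] with m hm i
        change χ₀ m * _ = _
        rw [hV m hm, one_mul]) D hD f
    rw [this, mul_eq_zero, sub_eq_zero]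
    right
    refine Finset.sum_congr rfl fun i _ => ?_
    rw [hu, hV b hbV, one_mul]
  · rw [image_eq_zero_of_notMem_tsupport hb, zero_mul]

end Charts

/-! ### Functions that are constant along the fibres -/

section Descent

variable {E F : Type*} [NormedAddCommGroup E] [NormedSpace ℝ E] [FiniteDimensional ℝ E]
  [NormedAddCommGroup F] [NormedSpace ℝ F]
  {M B : Type*} [TopologicalSpace M] [ChartedSpace E M] [IsManifold 𝓘(ℝ, E) ∞ M] [T2Space M]
  [TopologicalSpace B] [ChartedSpace F B]
  {p : C^∞⟮𝓘(ℝ, E), M; 𝓘(ℝ, F), B⟯}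

/-- A function annihilated by the vertical vector fields is, near every point, the pull-back of its
restriction along a smooth local section. -/
lemma exists_local_section (hp : Manifold.IsSubmersion 𝓘(ℝ, E) 𝓘(ℝ, F) ∞ p) {f : Fn E M}
    (hf : ∀ X : Ver p, (X : VField E M) f = 0) (m : M) :
    ∃ W ∈ nhds m, ∃ V ∈ nhds (p m), ∃ σ : B → M, ContMDiffAt 𝓘(ℝ, F) 𝓘(ℝ, E) ∞ σ (p m) ∧
      (∀ b ∈ V, p (σ b) = b) ∧ ∀ m' ∈ W, f m' = f (σ (p m')) := by
  obtain ⟨K, _, _, hK⟩ := hp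
  have hm := hK m
  set φ := hm.domChart with hφdef
  set ψ := hm.codChart with hψdef
  set e := hm.equiv
  have hφ : φ ∈ IsManifold.maximalAtlas 𝓘(ℝ, E) ∞ M := hm.domChart_mem_maximalAtlas
  have hψ : ψ ∈ IsManifold.maximalAtlas 𝓘(ℝ, F) ∞ B := hm.codChart_mem_maximalAtlas
  have hmφ : m ∈ φ.source := hm.mem_domChart_source
  have hmψ : p m ∈ ψ.source := hm.mem_codChart_source
  have hsrc : ∀ m' ∈ φ.source, p m' ∈ ψ.source := fun m' h => hm.source_subset_preimage_source h
  have hchart : ∀ x ∈ φ.target, ψ (p (φ.symm x)) = (e x).1 := fun x hx =>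
    hm.writtenInCharts (by simpa [OpenPartialHomeomorph.extend_target] using hx)
  have hpφ : ∀ x ∈ φ.target, p (φ.symm x) = ψ.symm (e x).1 := fun x hx => by
    rw [← hchart x hx, ψ.left_inv (hsrc _ (φ.map_target hx))]
  obtain ⟨χ, hχ1, hχs, -⟩ := exists_bump (E := E) (φ.open_source.mem_nhds hmφ)
  -- the derivatives of `f` in the directions of the fibre vanish near `m`
  have hder : ∀ m' ∈ φ.source, χ m' = 1 → ∀ k : K,
      fderiv ℝ (f ∘ φ.symm) (φ m') (e.symm (0, k)) = 0 := by
    intro m' hm' hχm' k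
    obtain ⟨X, hX⟩ := exists_coordDerivation hφ χ hχs (e.symm (0, k))
    have hver : X ∈ Ver p := by
      intro g
      ext m''
      rw [hX]
      change _ = (0 : ℝ)
      by_cases hm'' : m'' ∈ φ.source
      · set x := φ m''
        have hx : x ∈ φ.target := φ.map_source hm''
        have hd := (differentiableAt_comp_symm hφ (g.comp p) hm'').hasFDerivAt
        have hline : HasDerivAt (fun t : ℝ => x + t • e.symm (0, k)) (e.symm (0, k)) 0 := by
          simpa using ((hasDerivAt_id (0 : ℝ)).smul_const (e.symm (0, k))).const_add x
        have h0 : x + (0 : ℝ) • e.symm (0, k) = x := by simp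
        have hcomp := HasFDerivAt.comp_hasDerivAt (0 : ℝ) (by rw [h0]; exact hd) hline
        have hconst : ((g.comp p : Fn E M) ∘ φ.symm) ∘ (fun t : ℝ => x + t • e.symm (0, k))
            =ᶠ[nhds 0] fun _ => g (ψ.symm (e x).1) := by
          have hc : ContinuousAt (fun t : ℝ => x + t • e.symm (0, k)) 0 := hline.continuousAt
          filter_upwards [hc.preimage_mem_nhds (t := φ.target)
            (by simpa using φ.open_target.mem_nhds hx)] with t ht
          change g (p (φ.symm _)) = _
          rw [hpφ _ ht]
          simp
        have := hcomp.unique ((hasDerivAt_const (0 : ℝ) _).congr_of_eventuallyEq hconst)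
        rw [this, mul_zero]
      · rw [image_eq_zero_of_notMem_tsupport fun h => hm'' (hχs h), zero_mul]
    have h1 := congrArg (fun q : Fn E M => q m') (hf ⟨X, hver⟩)
    change X f m' = 0 at h1
    rwa [hX, hχm', one_mul] at h1
  -- a product neighbourhood on which this holds
  obtain ⟨O, hO, hOo, hmO⟩ := eventually_nhds_iff.1 hχ1
  set a := e (φ m)
  have hN : e.symm ⁻¹' (φ.target ∩ φ.symm ⁻¹' O) ∈ nhds a := by
    refine e.symm.continuous.continuousAt.preimage_mem_nhds ?_
    rw [e.symm_apply_apply]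
    exact (φ.isOpen_inter_preimage_symm hOo).mem_nhds
      ⟨φ.map_source hmφ, by rw [Set.mem_preimage, φ.left_inv hmφ]; exact hmO⟩
  obtain ⟨r, hr, hball⟩ := Metric.mem_nhds_iff.1 hN
  have hprod : ∀ x ∈ Metric.ball a.1 r, ∀ k ∈ Metric.ball a.2 r,
      e.symm (x, k) ∈ φ.target ∧ φ.symm (e.symm (x, k)) ∈ O := by
    intro x hx k hk
    refine @hball (x, k) ?_
    rw [Metric.mem_ball, Prod.dist_eq]
    exact max_lt hx hk
  have hconst : ∀ x ∈ Metric.ball a.1 r, ∀ k ∈ Metric.ball a.2 r,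
      f (φ.symm (e.symm (x, k))) = f (φ.symm (e.symm (x, a.2))) := by
    intro x hx k hk
    have hd : ∀ k ∈ Metric.ball a.2 r,
        HasFDerivAt (fun k => f (φ.symm (e.symm (x, k)))) (0 : K →L[ℝ] ℝ) k := by
      intro k hk
      obtain ⟨ht, hOk⟩ := hprod x hx k hk
      have h1 : HasFDerivAt (f ∘ φ.symm) (fderiv ℝ (f ∘ φ.symm) (e.symm (x, k))) (e.symm (x, k)) :=
        (((contDiffOn_comp_symm hφ f).contDiffAt
          (φ.open_target.mem_nhds ht)).differentiableAt (by simp)).hasFDerivAt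
      have h2 : HasFDerivAt (fun k => e.symm (x, k))
          ((e.symm : (F × K) →L[ℝ] E).comp (ContinuousLinearMap.inr ℝ F K)) k :=
        (e.symm : (F × K) →L[ℝ] E).hasFDerivAt.comp k (hasFDerivAt_prodMk_right x k)
      refine (h1.comp k h2).congr_fderiv ?_
      ext v
      have h3 := hder _ (φ.map_target ht) (hO _ hOk) v
      rw [φ.right_inv ht] at h3
      exact h3
    exact Metric.isOpen_ball.is_const_of_fderiv_eq_zero (𝕜 := ℝ)
      (convex_ball a.2 r).isPreconnected
      (fun k hk => (hd k hk).differentiableAt.differentiableWithinAt) (fun k hk => (hd k hk).fderiv)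
      hk (Metric.mem_ball_self hr)
  have ha1 : ψ (p m) = a.1 := by
    rw [← hchart _ (φ.map_source hmφ), φ.left_inv hmφ]
  have hpm : ∀ m' ∈ φ.source, ψ (p m') = (e (φ m')).1 := fun m' hm' => by
    rw [← hchart _ (φ.map_source hm'), φ.left_inv hm']
  refine ⟨φ.source ∩ φ ⁻¹' (e ⁻¹' (Metric.ball a.1 r ×ˢ Metric.ball a.2 r)), ?_,
    ψ.source ∩ ψ ⁻¹' Metric.ball a.1 r, ?_, fun b => φ.symm (e.symm (ψ b, a.2)), ?_, ?_, ?_⟩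
  · refine Filter.inter_mem (φ.open_source.mem_nhds hmφ)
      ((φ.continuousAt hmφ).preimage_mem_nhds (e.continuous.continuousAt.preimage_mem_nhds ?_))
    exact prod_mem_nhds (Metric.ball_mem_nhds _ hr) (Metric.ball_mem_nhds _ hr)
  · refine Filter.inter_mem (ψ.open_source.mem_nhds hmψ)
      ((ψ.continuousAt hmψ).preimage_mem_nhds ?_)
    rw [ha1]
    exact Metric.ball_mem_nhds _ hr
  · have h1 : ContMDiffAt 𝓘(ℝ, F) 𝓘(ℝ, F) ∞ ψ (p m) := contMDiffAt_of_mem_maximalAtlas hψ hmψ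
    have h2 : ContDiff ℝ ∞ fun y : F => e.symm (y, a.2) :=
      e.symm.contDiff.comp (contDiff_id.prodMk contDiff_const)
    have h3 : ContMDiffAt 𝓘(ℝ, E) 𝓘(ℝ, E) ∞ φ.symm (e.symm (ψ (p m), a.2)) := by
      refine contMDiffAt_symm_of_mem_maximalAtlas hφ ?_
      rw [ha1]
      exact (hprod a.1 (Metric.mem_ball_self hr) a.2 (Metric.mem_ball_self hr)).1
    exact h3.comp (p m) (h2.contMDiff.contMDiffAt.comp (p m) h1)
  · rintro b ⟨hbs, hbb⟩
    have ht := (hprod (ψ b) hbb a.2 (Metric.mem_ball_self hr)).1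
    change p (φ.symm _) = b
    rw [hpφ _ ht, e.apply_symm_apply, ψ.left_inv hbs]
  · rintro m' ⟨hs, h1, h2⟩
    have := hconst _ h1 _ h2
    rw [Prod.mk.eta, e.symm_apply_apply, φ.left_inv hs] at this
    change f m' = f (φ.symm (e.symm (ψ (p m'), a.2)))
    rw [this, hpm m' hs]

/-- A smooth function annihilated by the vertical vector fields is the pull-back of a smooth function
on the base, the fibres being connected. -/
lemma exists_comp_eq_of_ver_eq_zero (hp : Manifold.IsSubmersion 𝓘(ℝ, E) 𝓘(ℝ, F) ∞ p)
    (hfib : ∀ b : B, IsConnected (p ⁻¹' {b})) {f : Fn E M}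
    (hf : ∀ X : Ver p, (X : VField E M) f = 0) : ∃ g : Fn F B, g.comp p = f := by
  choose s hs using fun b => (hfib b).nonempty
  have hconst : ∀ m m' : M, p m = p m' → f m = f m' := by
    intro m m' hmm
    have : PreconnectedSpace (p ⁻¹' {p m}) :=
      isPreconnected_iff_preconnectedSpace.1 (hfib (p m)).isPreconnected
    have hloc : IsLocallyConstant fun x : p ⁻¹' {p m} => f x := by
      rw [IsLocallyConstant.iff_eventually_eq]
      rintro ⟨x, hx⟩
      obtain ⟨W, hW, V, -, σ, -, -, hσ⟩ := exists_local_section hp hf x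
      filter_upwards [continuous_subtype_val.continuousAt.preimage_mem_nhds hW] with y hy
      rw [hσ y hy, hσ x (mem_of_mem_nhds hW)]
      rw [show p y = p m from y.2, show p x = p m from hx]
    exact hloc.apply_eq_of_preconnectedSpace ⟨m, rfl⟩ ⟨m', hmm.symm⟩
  have hsm : ∀ m, f (s (p m)) = f m := fun m => hconst _ _ (hs (p m))
  refine ⟨⟨fun b => f (s b), fun b => ?_⟩, ?_⟩
  · obtain ⟨W, hW, V, hV, σ, hσ, hsec, -⟩ := exists_local_section hp hf (s b)
    rw [show p (s b) = b from hs b] at hV hσ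
    have h1 : ContMDiffAt 𝓘(ℝ, F) 𝓘(ℝ, ℝ) ∞ (fun b' => f (σ b')) b :=
      f.contMDiff.contMDiffAt.comp b hσ
    refine h1.congr_of_eventuallyEq ?_
    filter_upwards [hV] with b' hb'
    exact hconst _ _ (by rw [hsec b' hb']; exact hs b')
  · ext m
    exact hsm m

omit [FiniteDimensional ℝ E] [IsManifold 𝓘(ℝ, E) ∞ M] [T2Space M] in
lemma comp_injective (hfib : ∀ b : B, IsConnected (p ⁻¹' {b})) {g g' : Fn F B}
    (h : (g.comp p : Fn E M) = g'.comp p) : g = g' := by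
  ext b
  obtain ⟨m, rfl⟩ := (hfib b).nonempty
  exact congrArg (fun q : Fn E M => q m) h

omit [FiniteDimensional ℝ E] [IsManifold 𝓘(ℝ, E) ∞ M] [T2Space M] in
lemma dV_zero_apply {k : ℕ} (Θ : Cochain p k 0) (v : Fin k → VField F B) (w : Fin 1 → Ver p) :
    dV p k 0 Θ v w = (-1 : ℝ) ^ k • (w 0 : VField E M) (Θ v Fin.elim0) := by
  change (-1 : ℝ) ^ k • koszul _ 0 (Θ v) w = _
  rw [koszul_zero_apply]
  rfl

/-- A form on the base with values in functions on `M` that is `d^V`-closed is the pull-back of a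
form on the base. -/
lemma exists_pullbackForm_eq (hp : Manifold.IsSubmersion 𝓘(ℝ, E) 𝓘(ℝ, F) ∞ p)
    (hfib : ∀ b : B, IsConnected (p ⁻¹' {b})) {k : ℕ} {Θ : Cochain p k 0}
    (hΘ : Θ ∈ mixedForms p k 0) (hd : dV p k 0 Θ = 0) :
    ∃ φ : Form F B k, pullbackForm p φ = Θ := by
  have hver : ∀ (v : Fin k → VField F B) (X : Ver p), (X : VField E M) (Θ v Fin.elim0) = 0 := by
    intro v X
    have h1 := congrFun (congrFun hd v) fun _ => X
    rw [dV_zero_apply] at h1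
    exact (smul_eq_zero.1 h1).resolve_left (pow_ne_zero _ (by norm_num))
  choose φ hφ using fun v => exists_comp_eq_of_ver_eq_zero hp hfib (hver v)
  refine ⟨⟨⟨φ, ?_, ?_⟩, ?_⟩, ?_⟩
  · intro inst v i u u'
    obtain rfl : inst = instDecidableEqFin k := Subsingleton.elim _ _
    refine comp_injective (E := E) hfib ?_
    rw [hφ, ContMDiffMap.add_comp, hφ, hφ, hΘ.map_add]
    rfl
  · intro inst v i g u
    obtain rfl : inst = instDecidableEqFin k := Subsingleton.elim _ _
    refine comp_injective (E := E) hfib ?_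
    rw [hφ, smul_eq_mul, ContMDiffMap.mul_comp, hφ, hΘ.map_smul]
  · intro v i j hv hij
    refine comp_injective (E := E) hfib ?_
    change (φ v).comp p = _
    rw [hφ, hΘ.alternating v i j hij hv]
    rfl
  · funext v w
    refine (hφ v).trans ?_
    exact congrArg _ (Subsingleton.elim _ _)

end Descent

/-! ### Local splittings of the vector fields on the total space -/

section Splitting

variable {E F : Type*} [NormedAddCommGroup E] [NormedSpace ℝ E]
  [NormedAddCommGroup F] [NormedSpace ℝ F]
  {M B : Type*} [TopologicalSpace M] [ChartedSpace E M] [TopologicalSpace B] [ChartedSpace F B]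
  {p : C^∞⟮𝓘(ℝ, E), M; 𝓘(ℝ, F), B⟯}

namespace EhresmannConnection

variable (h : EhresmannConnection p)

lemma lift_zero : h.lift 0 = 0 := by
  have := h.lift_add 0 0
  rw [add_zero] at this
  exact left_eq_add.1 this

lemma lift_sum {ι : Type*} (s : Finset ι) (u : ι → VField F B) :
    h.lift (∑ i ∈ s, u i) = ∑ i ∈ s, h.lift (u i) :=
  map_sum (⟨⟨h.lift, h.lift_zero⟩, h.lift_add⟩ : VField F B →+ VField E M) u s

lemma lift_sub (u v : VField F B) : h.lift (u - v) = h.lift u - h.lift v :=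
  map_sub (⟨⟨h.lift, h.lift_zero⟩, h.lift_add⟩ : VField F B →+ VField E M) u v

/-- A splitting of the vector fields on `M` over the region of `B` where the cutoff function `χ`
is `1`: the vector fields `u i` on `B` are a frame there, `θ i` are one-forms on `M` that pull
back the dual coframe, and `Q` is the projection to the vertical fields. -/
structure LocalSplitting where
  /-- The cutoff function. -/
  χ : Fn F B
  /-- The number of vector fields in the frame. -/
  n : ℕ
  /-- The functions on the base whose differentials form the coframe. -/
  x : Fin n → Fn F B
  /-- The frame. -/
  u : Fin n → VField F B
  /-- The vertical projection, multiplied by the cutoff function. -/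
  Q : VField E M →ₗ[Fn E M] Ver p
  Q_apply : ∀ X : VField E M, (Q X : VField E M) =
    (χ.comp p : Fn E M) • (X - ∑ i, X ((x i).comp p) • h.lift (u i))
  smul_eq : ∀ v : VField F B, χ • v = χ • ∑ i, v (x i) • u i

lemma exists_localSplitting [FiniteDimensional ℝ F] [IsManifold 𝓘(ℝ, F) ∞ B] [T2Space B] (b₀ : B) :
    ∃ S : h.LocalSplitting, ∀ᶠ b in nhds b₀, S.χ b = 1 := by
  obtain ⟨χ, n, x, u, hχ, hD⟩ := exists_local_frame (E := F) b₀
  let P : VField E M →ₗ[Fn E M] VField E M :=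
    { toFun := fun X => (χ.comp p : Fn E M) • (X - ∑ i, X ((x i).comp p) • h.lift (u i))
      map_add' := fun X Y => by
        simp only [Derivation.add_apply, add_smul, Finset.sum_add_distrib, ← smul_add]
        congr 1
        abel
      map_smul' := fun f X => by
        simp only [Derivation.smul_apply, smul_assoc, RingHom.id_apply, ← Finset.smul_sum,
          ← smul_sub]
        exact smul_comm _ _ _ }
  have hP : ∀ X, P X ∈ Ver p := by
    intro X g
    ext m
    let D : Fn F B →ₗ[ℝ] ℝ :=
      { toFun := fun g => X (g.comp p) m
        map_add' := fun f g => by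
          rw [ContMDiffMap.add_comp, map_add]
          rfl
        map_smul' := fun c f => by
          rw [ContMDiffMap.smul_comp, Derivation.map_smul]
          rfl }
    have hDl : ∀ f g, D (f * g) = f (p m) * D g + g (p m) * D f := by
      intro f g
      change X ((f * g).comp p) m = _
      rw [ContMDiffMap.mul_comp, Derivation.leibniz]
      rfl
    have h1 := hD (p m) D hDl g
    have hev : ∀ (Y : Fin n → VField E M) (f : Fn E M), (∑ i, Y i) f m = ∑ i, Y i f m := by
      intro Y f
      exact map_sum (⟨⟨fun Z : VField E M => Z f m, rfl⟩, fun _ _ => rfl⟩ : VField E M →+ ℝ) Y _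
    change χ (p m) * (X (g.comp p) m - (∑ i, X ((x i).comp p) • h.lift (u i)) (g.comp p) m) = 0
    rw [hev]
    refine Eq.trans ?_ h1
    congr 2
    refine Finset.sum_congr rfl fun i _ => ?_
    change X ((x i).comp p) m * h.lift (u i) (g.comp p) m = _
    rw [h.lift_apply_comp]
    rfl
  refine ⟨⟨χ, n, x, u, P.codRestrict (Ver p) hP, fun X => rfl, fun v => ?_⟩, hχ⟩
  ext g b
  have h1 := hD b ⟨⟨fun g => v g b, fun f g => by rw [map_add]; rfl⟩,
    fun c f => by change v (c • f) b = c * v f b; rw [Derivation.map_smul]; rfl⟩ (fun f g => by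
      change v (f * g) b = _
      rw [Derivation.leibniz]
      rfl) g
  have hev : (∑ i, v (x i) • u i) g b = ∑ i, v (x i) b * u i g b :=
    map_sum (⟨⟨fun Z : VField F B => Z g b, rfl⟩, fun _ _ => rfl⟩ : VField F B →+ ℝ)
      (fun i => v (x i) • u i) _
  change χ b * v g b = χ b * (∑ i, v (x i) • u i) g b
  rw [hev]
  rw [mul_sub, sub_eq_zero] at h1
  exact h1

namespace LocalSplitting

variable {h} (S : h.LocalSplitting)

/-- The one-form `X ↦ X (x i)` on the total space. -/
def θ (i : Fin S.n) : VField E M →ₗ[Fn E M] Fn E M where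
  toFun X := X ((S.x i).comp p)
  map_add' _ _ := rfl
  map_smul' _ _ := rfl

lemma θ_ver (i : Fin S.n) (w : Ver p) : S.θ i w = 0 := w.2 _

lemma θ_lift (i : Fin S.n) (v : VField F B) : S.θ i (h.lift v) = (v (S.x i)).comp p :=
  h.lift_apply_comp _ _

lemma Q_ver (w : Ver p) : S.Q w = (S.χ.comp p : Fn E M) • w := by
  apply Subtype.ext
  rw [S.Q_apply]
  rw [Finset.sum_eq_zero fun i _ => by rw [w.2, zero_smul], sub_zero]
  rfl

lemma Q_lift (v : VField F B) : S.Q (h.lift v) = 0 := by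
  apply Subtype.ext
  rw [S.Q_apply]
  simp only [h.lift_apply_comp, ← h.lift_smul, ← h.lift_sum, ← h.lift_sub]
  rw [smul_sub, ← S.smul_eq, sub_self, h.lift_zero]
  rfl

lemma smul_vec (X : VField E M) : (S.χ.comp p : Fn E M) • X =
    S.Q X + ∑ i, ((S.χ.comp p : Fn E M) * S.θ i X) • h.lift (S.u i) := by
  rw [S.Q_apply, smul_sub, Finset.smul_sum]
  simp only [mul_smul]
  exact (sub_add_cancel _ _).symm

/-- Expansion of a mixed form in the frame, in one of its arguments on the base. -/
lemma mixed_expand {r s : ℕ} {Θ : Cochain p r s} (hΘ : Θ ∈ mixedForms p r s) (y : Fin r → VField F B)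
    (j : Fin r) (v : VField F B) (w : Fin s → Ver p) {m : M} (hm : S.χ (p m) = 1) :
    Θ (Function.update y j v) w m =
      ∑ i, v (S.x i) (p m) * Θ (Function.update y j (S.u i)) w m := by
  have hz : Θ (Function.update y j 0) w = 0 := by
    have := hΘ.map_smul y j 0 0 w
    rw [zero_smul] at this
    rw [this]
    ext m
    exact zero_mul _
  let A : VField F B →+ Fn E M :=
    ⟨⟨fun v => Θ (Function.update y j v) w, hz⟩, fun u u' => by
      change Θ _ w = Θ _ w + Θ _ w
      rw [hΘ.map_add]
      rfl⟩
  have hA : ∀ (g : Fn F B) u, A (g • u) = g.comp p * A u := fun g u => hΘ.map_smul y j g u w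
  have h1 : A (S.χ • v) = S.χ.comp p * A v := hA _ _
  rw [S.smul_eq v, hA, map_sum] at h1
  have h2 := congrArg (fun q : Fn E M => q m) h1
  change S.χ (p m) * (∑ i, A (v (S.x i) • S.u i) : Fn E M) m = S.χ (p m) * A v m at h2
  rw [hm, one_mul, one_mul] at h2
  refine h2.symm.trans ?_
  refine (map_sum (ContMDiffMap.evalRingHom (I := 𝓘(ℝ, E)) (n := ∞) (R := ℝ) m) _ _).trans ?_
  refine Finset.sum_congr rfl fun i _ => ?_
  rw [hA]
  rfl

end LocalSplitting

variable [FiniteDimensional ℝ F] [IsManifold 𝓘(ℝ, F) ∞ B] [T2Space B]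

/-- A form vanishes if it vanishes on vertical vector fields and horizontal lifts. -/
lemma form_eq_zero_of_split {k : ℕ} (Ξ : Form E M k)
    (hΞ : ∀ X : Fin k → VField E M, (∀ i, X i ∈ Ver p ∨ X i ∈ Set.range h.lift) → Ξ X = 0) :
    Ξ = 0 := by
  induction k with
  | zero => exact AlternatingMap.ext fun X => hΞ X fun i => i.elim0
  | succ k ih =>
    have hsplit : ∀ X : VField E M, X ∈ Ver p ∨ X ∈ Set.range h.lift → Ξ.curryLeft X = 0 :=
      fun X hX => ih _ fun Y hY => hΞ (Fin.cons X Y) fun i => Fin.cases hX hY i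
    refine AlternatingMap.ext fun X => ?_
    ext m
    obtain ⟨S, hS⟩ := h.exists_localSplitting (p m)
    have h1 : (S.χ.comp p : Fn E M) • Ξ.curryLeft (X 0) = 0 := by
      rw [← map_smul, S.smul_vec, map_add, map_sum, hsplit _ (Or.inl (S.Q _).2), zero_add]
      refine Finset.sum_eq_zero fun i _ => ?_
      rw [map_smul, hsplit _ (Or.inr ⟨_, rfl⟩), smul_zero]
    have h2 := congrArg (fun q : Fn E M => q m) (DFunLike.congr_fun h1 (Fin.tail X))
    change S.χ (p m) * Ξ (Fin.cons (X 0) (Fin.tail X)) m = 0 at h2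
    rw [hS.self_of_nhds, one_mul, Fin.cons_self_tail] at h2
    exact h2

/-- A form vanishes if all its components vanish. -/
lemma form_eq_zero_of_components {k : ℕ} (Ξ : Form E M k)
    (hΞ : ∀ (r : ℕ) (X : Fin k → VField E M), r ≤ k →
      (∀ i : Fin k, (i : ℕ) < r → X i ∈ Set.range h.lift) →
      (∀ i : Fin k, r ≤ (i : ℕ) → X i ∈ Ver p) → Ξ X = 0) : Ξ = 0 := by
  induction k with
  | zero => exact AlternatingMap.ext fun X => hΞ 0 X le_rfl (fun i => i.elim0) fun i => i.elim0
  | succ k ih =>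
    have hlift : ∀ v : VField F B, Ξ.curryLeft (h.lift v) = 0 := by
      refine fun v => ih _ fun r X hr h1 h2 => hΞ (r + 1) (Fin.cons (h.lift v) X) (by omega) ?_ ?_
      · intro i hi
        induction i using Fin.cases with
        | zero => exact ⟨v, rfl⟩
        | succ i => exact h1 i (by simpa using hi)
      · intro i hi
        induction i using Fin.cases with
        | zero => simp at hi
        | succ i => exact h2 i (by simpa using hi)
    refine h.form_eq_zero_of_split Ξ fun X hX => ?_
    by_cases hall : ∃ i, X i ∈ Set.range h.lift
    · obtain ⟨i, v, hv⟩ := hall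
      have h1 := Ξ.map_insertNth i (X i) (i.removeNth X)
      rw [Fin.insertNth_self_removeNth] at h1
      rw [h1, ← hv]
      have h2 := DFunLike.congr_fun (hlift v) (i.removeNth X)
      change Ξ (Matrix.vecCons (h.lift v) (i.removeNth X)) = 0 at h2
      rw [h2, smul_zero]
    · push Not at hall
      exact hΞ 0 X (by omega) (fun i hi => absurd hi (by omega))
        fun i _ => (hX i).resolve_right (hall i)

/-- If all components of a form vanish except the purely horizontal one, its contractions with
vertical fields vanish. -/
lemma curryLeft_ver_eq_zero {k : ℕ} (Ξ : Form E M (k + 1))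
    (hΞ : ∀ (r : ℕ) (X : Fin (k + 1) → VField E M), r ≤ k →
      (∀ i : Fin (k + 1), (i : ℕ) < r → X i ∈ Set.range h.lift) →
      (∀ i : Fin (k + 1), r ≤ (i : ℕ) → X i ∈ Ver p) → Ξ X = 0) (w : Ver p) :
    Ξ.curryLeft (w : VField E M) = 0 := by
  refine h.form_eq_zero_of_components _ fun r X hr h1 h2 => ?_
  -- move the vertical field to the last place
  have h3 := Ξ.neg_one_pow_smul_map_insertNth (Fin.last k) (w : VField E M) X
  change Ξ (Matrix.vecCons (w : VField E M) X) = 0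
  rw [← h3, hΞ r _ hr, smul_zero]
  · intro i hi
    induction i using Fin.lastCases with
    | last => simp at hi; omega
    | cast i => simpa using h1 i (by simpa using hi)
  · intro i hi
    induction i using Fin.lastCases with
    | last => simp
    | cast i => simpa using h2 i (by simpa using hi)

end EhresmannConnection

end Splitting

/-! ### Assembling a form from its components -/

section Wedge

variable {R V : Type*} [CommRing R] [AddCommGroup V] [Module R V]

/-- The wedge product `θ ∧ η` of a one-form and a form. -/
def wedgeOne {k : ℕ} (θ : V →ₗ[R] R) (η : V [⋀^Fin k]→ₗ[R] R) : V [⋀^Fin (k + 1)]→ₗ[R] R :=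
  AlternatingMap.alternatizeUncurryFin (θ.smulRight η)

lemma wedgeOne_apply {k : ℕ} (θ : V →ₗ[R] R) (η : V [⋀^Fin k]→ₗ[R] R) (v : Fin (k + 1) → V) :
    wedgeOne θ η v = ∑ i : Fin (k + 1), (-1) ^ (i : ℕ) • (θ (v i) * η (i.removeNth v)) := by
  rw [wedgeOne, AlternatingMap.alternatizeUncurryFin_apply]
  rfl

lemma wedgeOne_apply_one (θ : V →ₗ[R] R) (η : V [⋀^Fin 0]→ₗ[R] R) (a : V) :
    wedgeOne θ η ![a] = θ a * η ![] := by
  rw [wedgeOne_apply, Fin.sum_univ_one]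
  have : (Fin.removeNth 0 ![a] : Fin 0 → V) = ![] := Subsingleton.elim _ _
  simp [this]

lemma wedgeOne_apply_two (θ : V →ₗ[R] R) (η : V [⋀^Fin 1]→ₗ[R] R) (a b : V) :
    wedgeOne θ η ![a, b] = θ a * η ![b] - θ b * η ![a] := by
  rw [wedgeOne_apply, Fin.sum_univ_two]
  have e0 : (Fin.removeNth 0 ![a, b] : Fin 1 → V) = ![b] := by funext i; fin_cases i; rfl
  have e1 : (Fin.removeNth 1 ![a, b] : Fin 1 → V) = ![a] := by funext i; fin_cases i; rfl
  simp [e0, e1]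
  ring

lemma wedgeOne_apply_three (θ : V →ₗ[R] R) (η : V [⋀^Fin 2]→ₗ[R] R) (a b c : V) :
    wedgeOne θ η ![a, b, c] = θ a * η ![b, c] - θ b * η ![a, c] + θ c * η ![a, b] := by
  rw [wedgeOne_apply, Fin.sum_univ_three]
  have e0 : (Fin.removeNth 0 ![a, b, c] : Fin 2 → V) = ![b, c] := by
    funext i; fin_cases i <;> rfl
  have e1 : (Fin.removeNth 1 ![a, b, c] : Fin 2 → V) = ![a, c] := by
    funext i; fin_cases i <;> rfl
  have e2 : (Fin.removeNth 2 ![a, b, c] : Fin 2 → V) = ![a, b] := by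
    funext i; fin_cases i <;> rfl
  simp [e0, e1, e2]
  ring

end Wedge

section Glue

variable {E F : Type*} [NormedAddCommGroup E] [NormedSpace ℝ E]
  [NormedAddCommGroup F] [NormedSpace ℝ F]
  {M B : Type*} [TopologicalSpace M] [ChartedSpace E M] [TopologicalSpace B] [ChartedSpace F B]
  {p : C^∞⟮𝓘(ℝ, E), M; 𝓘(ℝ, F), B⟯}

open Function in
/-- A locally finite combination of forms, for a partition of unity on the base. -/
lemma exists_glued_form {ι : Type*} (ρ : SmoothPartitionOfUnity ι 𝓘(ℝ, F) B Set.univ) {k : ℕ}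
    (Φ : ι → Form E M k) :
    ∃ Ψ : Form E M k, ∀ v m, Ψ v m = ∑ᶠ i, ρ i (p m) * Φ i v m := by
  have hfin : ∀ v m, (support fun i => ρ i (p m) * Φ i v m).Finite := fun v m =>
    (ρ.locallyFinite.point_finite (p m)).subset fun i hi => left_ne_zero_of_mul hi
  have hsm : ∀ v, ContMDiff 𝓘(ℝ, E) 𝓘(ℝ, ℝ) ∞ fun m => ∑ᶠ i, ρ i (p m) * Φ i v m := by
    intro v
    refine contMDiff_finsum (fun i => ((ρ i).contMDiff.comp p.contMDiff).mul (Φ i v).contMDiff) ?_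
    refine (ρ.locallyFinite.preimage_continuous p.contMDiff.continuous).subset fun i m hm => ?_
    exact left_ne_zero_of_mul hm
  refine ⟨⟨⟨fun v => ⟨_, hsm v⟩, ?_, ?_⟩, ?_⟩, fun v m => rfl⟩
  · intro _ v i X Y
    ext m
    change ∑ᶠ j, ρ j (p m) * Φ j _ m =
      (∑ᶠ j, ρ j (p m) * Φ j _ m) + ∑ᶠ j, ρ j (p m) * Φ j _ m
    rw [← finsum_add_distrib (hfin _ m) (hfin _ m)]
    refine finsum_congr fun j => ?_
    rw [AlternatingMap.map_update_add, ← mul_add]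
    rfl
  · intro _ v i f X
    ext m
    change ∑ᶠ j, ρ j (p m) * Φ j _ m = f m * ∑ᶠ j, ρ j (p m) * Φ j _ m
    rw [mul_finsum' _ _ (hfin _ m)]
    refine finsum_congr fun j => ?_
    rw [AlternatingMap.map_update_smul]
    change _ * (f m * _) = _
    ring
  · intro v i j hv hij
    ext m
    change ∑ᶠ l, ρ l (p m) * Φ l v m = (0 : ℝ)
    refine finsum_eq_zero_of_forall_eq_zero fun l => ?_
    rw [(Φ l).map_eq_zero_of_eq v hv hij]
    exact mul_zero _

/-- A mixed form is alternating over `ℝ` in the vector fields on the base. -/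
lemma isAlt_of_mem_mixedForms {r s : ℕ} {Θ : Cochain p r s} (hΘ : Θ ∈ mixedForms p r s) :
    IsAlt ℝ Θ := by
  refine ⟨⟨⟨Θ, ?_, ?_⟩, fun v i j hv hij => hΘ.alternating v i j hij hv⟩, rfl⟩
  · intro inst v i u u'
    obtain rfl : inst = instDecidableEqFin r := Subsingleton.elim _ _
    exact hΘ.map_add v i u u'
  · intro inst v i c u
    obtain rfl : inst = instDecidableEqFin r := Subsingleton.elim _ _
    funext w
    have h1 := hΘ.map_smul v i (algebraMap ℝ (Fn F B) c) u w
    rw [algebraMap_smul] at h1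
    rw [h1]
    ext m
    rfl

namespace EhresmannConnection

variable {h : EhresmannConnection p}

/-- The form with given components over the region where a splitting is valid. -/
lemma LocalSplitting.exists_form (S : h.LocalSplitting) (ΦV : VForm p 3) {αH : Cochain p 1 2}
    (hα : αH ∈ mixedForms p 1 2) {ωH : Cochain p 2 1} (hω : ωH ∈ mixedForms p 2 1)
    {ΦH : Cochain p 3 0} (hΦ : ΦH ∈ mixedForms p 3 0) :
    ∃ Φ : Form E M 3, ∀ m : M, S.χ (p m) = 1 →
      (∀ w₀ w₁ w₂ : Ver p, Φ ![(w₀ : VField E M), w₁, w₂] m = ΦV ![w₀, w₁, w₂] m) ∧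
      (∀ (u : VField F B) (w₀ w₁ : Ver p), Φ ![h.lift u, w₀, w₁] m = αH ![u] ![w₀, w₁] m) ∧
      (∀ (u v : VField F B) (w : Ver p), Φ ![h.lift u, h.lift v, w] m = ωH ![u, v] ![w] m) ∧
      (∀ u v x : VField F B, Φ ![h.lift u, h.lift v, h.lift x] m = ΦH ![u, v, x] ![] m) := by
  choose η hη using hα.vertical
  choose ζ hζ using hω.vertical
  let Φ0 : Form E M 3 := ΦV.compLinearMap S.Q
  let Φ1 : Form E M 3 := ∑ i, wedgeOne (S.θ i) ((η ![S.u i]).compLinearMap S.Q)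
  let Φ2 : Form E M 3 := ∑ i, ∑ j,
    wedgeOne (S.θ i) (wedgeOne (S.θ j) ((ζ ![S.u i, S.u j]).compLinearMap S.Q))
  let Φ3 : Form E M 3 := ∑ i, ∑ j, ∑ k, wedgeOne (S.θ i) (wedgeOne (S.θ j) (wedgeOne (S.θ k)
    (AlternatingMap.constOfIsEmpty (Fn E M) (VField E M) (Fin 0) (ΦH ![S.u i, S.u j, S.u k] ![]))))
  -- the sums run over all tuples of indices, not over the increasing ones
  refine ⟨Φ0 + Φ1 + (2⁻¹ : ℝ) • Φ2 + (6⁻¹ : ℝ) • Φ3, fun m hm => ?_⟩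
  have hsum : ∀ {k : ℕ} (f : Fin k → Fn E M), (∑ i, f i : Fn E M) m = ∑ i, f i m := fun f =>
    map_sum (ContMDiffMap.evalRingHom (I := 𝓘(ℝ, E)) (n := ∞) (R := ℝ) m) f _
  have hsumapp : ∀ {k : ℕ} (f : Fin k → Form E M 3) (X : Fin 3 → VField E M),
      (∑ i, f i) X = ∑ i, f i X := fun f X =>
    map_sum (⟨⟨fun Φ => Φ X, rfl⟩, fun _ _ => rfl⟩ : Form E M 3 →+ Fn E M) f _
  have happ : ∀ X : Fin 3 → VField E M, (Φ0 + Φ1 + (2⁻¹ : ℝ) • Φ2 + (6⁻¹ : ℝ) • Φ3) X m =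
      Φ0 X m + Φ1 X m + 2⁻¹ * Φ2 X m + 6⁻¹ * Φ3 X m := fun X => rfl
  have hcomp : ∀ (η : VForm p 2) (a b : VField E M),
      η.compLinearMap S.Q ![a, b] = η ![S.Q a, S.Q b] := by
    intro η a b
    change η _ = _
    congr 1
    funext i
    fin_cases i <;> rfl
  have hcomp' : ∀ (η : VForm p 1) (a : VField E M), η.compLinearMap S.Q ![a] = η ![S.Q a] := by
    intro η a
    change η _ = _
    congr 1
    funext i
    fin_cases i
    rfl
  have h0 : ∀ a b c, Φ0 ![a, b, c] = ΦV ![S.Q a, S.Q b, S.Q c] := by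
    intro a b c
    change ΦV _ = _
    congr 1
    funext i
    fin_cases i <;> rfl
  have h1 : ∀ a b c, Φ1 ![a, b, c] = ∑ i, (S.θ i a * αH ![S.u i] ![S.Q b, S.Q c]
      - S.θ i b * αH ![S.u i] ![S.Q a, S.Q c] + S.θ i c * αH ![S.u i] ![S.Q a, S.Q b]) := by
    intro a b c
    simp only [Φ1, hsumapp, wedgeOne_apply_three, hcomp, hη]
  have h2 : ∀ a b c, Φ2 ![a, b, c] = ∑ i, ∑ j,
      (S.θ i a * (S.θ j b * ωH ![S.u i, S.u j] ![S.Q c] - S.θ j c * ωH ![S.u i, S.u j] ![S.Q b])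
      - S.θ i b * (S.θ j a * ωH ![S.u i, S.u j] ![S.Q c] - S.θ j c * ωH ![S.u i, S.u j] ![S.Q a])
      + S.θ i c *
        (S.θ j a * ωH ![S.u i, S.u j] ![S.Q b] - S.θ j b * ωH ![S.u i, S.u j] ![S.Q a])) := by
    intro a b c
    simp only [Φ2, hsumapp, wedgeOne_apply_three, wedgeOne_apply_two, hcomp', hζ]
  have h3 : ∀ a b c, Φ3 ![a, b, c] = ∑ i, ∑ j, ∑ k,
      (S.θ i a * (S.θ j b * S.θ k c - S.θ j c * S.θ k b)
      - S.θ i b * (S.θ j a * S.θ k c - S.θ j c * S.θ k a)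
      + S.θ i c * (S.θ j a * S.θ k b - S.θ j b * S.θ k a)) * ΦH ![S.u i, S.u j, S.u k] ![] := by
    intro a b c
    simp only [Φ3, hsumapp, wedgeOne_apply_three, wedgeOne_apply_two,
      wedgeOne_apply_one, AlternatingMap.constOfIsEmpty_apply, Function.const_apply]
    refine Finset.sum_congr rfl fun i _ => Finset.sum_congr rfl fun j _ =>
      Finset.sum_congr rfl fun k _ => ?_
    ring
  -- vertical arguments: at `m` the projection `Q` is the identity on vertical fields
  have hQ : ∀ {s : ℕ} (η : VForm p s) (w : Fin s → Ver p),
      η (fun i => S.Q (w i : VField E M)) m = η w m := by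
    intro s η w
    simp only [S.Q_ver]
    rw [η.map_smul_univ]
    change (∏ _ : Fin s, (S.χ.comp p : Fn E M) : Fn E M) m * η w m = _
    rw [Finset.prod_const]
    change S.χ (p m) ^ _ * _ = _
    rw [hm, one_pow, one_mul]
  have hQ3 : ∀ w₀ w₁ w₂ : Ver p, ΦV ![S.Q w₀, S.Q w₁, S.Q w₂] m = ΦV ![w₀, w₁, w₂] m := by
    intro w₀ w₁ w₂
    rw [← hQ ΦV ![w₀, w₁, w₂]]
    congr 2
    funext i
    fin_cases i <;> rfl
  have hQ2 : ∀ u (w₀ w₁ : Ver p), αH u ![S.Q w₀, S.Q w₁] m = αH u ![w₀, w₁] m := by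
    intro u w₀ w₁
    rw [hη, ← hQ (η u) ![w₀, w₁]]
    congr 2
    funext i
    fin_cases i <;> rfl
  have hQ1 : ∀ u (w : Ver p), ωH u ![S.Q w] m = ωH u ![w] m := by
    intro u w
    rw [hζ, ← hQ (ζ u) ![w]]
    congr 2
    funext i
    fin_cases i
    rfl
  have hα0 : ∀ u w, αH u ![0, w] = 0 := fun u w => by
    rw [hη]
    exact (η u).map_coord_zero 0 rfl
  have hα1 : ∀ u w, αH u ![w, 0] = 0 := fun u w => by
    rw [hη]
    exact (η u).map_coord_zero 1 rfl
  have hω0 : ∀ u, ωH u ![0] = 0 := fun u => by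
    rw [hζ]
    exact (ζ u).map_coord_zero 0 rfl
  have hV0 : ∀ w w', ΦV ![0, w, w'] = 0 := fun w w' => ΦV.map_coord_zero 0 rfl
  -- expansions in the frame
  have hα_exp : ∀ u w, αH ![u] w m = ∑ i, u (S.x i) (p m) * αH ![S.u i] w m := by
    intro u w
    have e : ∀ v, Function.update ![(0 : VField F B)] 0 v = ![v] := fun v => by
      funext i; fin_cases i; rfl
    simpa only [e] using S.mixed_expand hα ![0] 0 u w hm
  have hω_exp : ∀ u v w, ωH ![u, v] w m =
      ∑ i, ∑ j, u (S.x i) (p m) * (v (S.x j) (p m) * ωH ![S.u i, S.u j] w m) := by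
    intro u v w
    have e0 : ∀ y, Function.update ![u, v] 0 y = ![y, v] := fun y => by
      funext i; fin_cases i <;> rfl
    have e1 : ∀ z y, Function.update ![z, v] 1 y = ![z, y] := fun z y => by
      funext i; fin_cases i <;> rfl
    have h4 := S.mixed_expand hω ![u, v] 0 u w hm
    simp only [e0] at h4
    rw [h4]
    refine Finset.sum_congr rfl fun i _ => ?_
    have h5 := S.mixed_expand hω ![S.u i, v] 1 v w hm
    simp only [e1] at h5
    rw [h5, Finset.mul_sum]
  have hΦ_exp : ∀ u v x w, ΦH ![u, v, x] w m = ∑ i, ∑ j, ∑ k, u (S.x i) (p m) *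
      (v (S.x j) (p m) * (x (S.x k) (p m) * ΦH ![S.u i, S.u j, S.u k] w m)) := by
    intro u v x w
    have e0 : ∀ y, Function.update ![u, v, x] 0 y = ![y, v, x] := fun y => by
      funext i; fin_cases i <;> rfl
    have e1 : ∀ z y, Function.update ![z, v, x] 1 y = ![z, y, x] := fun z y => by
      funext i; fin_cases i <;> rfl
    have e2 : ∀ z z' y, Function.update ![z, z', x] 2 y = ![z, z', y] := fun z z' y => by
      funext i; fin_cases i <;> rfl
    have h4 := S.mixed_expand hΦ ![u, v, x] 0 u w hm
    simp only [e0] at h4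
    rw [h4]
    refine Finset.sum_congr rfl fun i _ => ?_
    have h5 := S.mixed_expand hΦ ![S.u i, v, x] 1 v w hm
    simp only [e1] at h5
    rw [h5, Finset.mul_sum]
    refine Finset.sum_congr rfl fun j _ => ?_
    have h6 := S.mixed_expand hΦ ![S.u i, S.u j, x] 2 x w hm
    simp only [e2] at h6
    rw [h6, Finset.mul_sum, Finset.mul_sum]
  obtain ⟨ω', hω'⟩ := isAlt_of_mem_mixedForms hω
  obtain ⟨Φ', hΦ'⟩ := isAlt_of_mem_mixedForms hΦ
  refine ⟨fun w₀ w₁ w₂ => ?_, fun u w₀ w₁ => ?_, fun u v w => ?_, fun u v x => ?_⟩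
  · rw [happ, h0, h1, h2, h3, hQ3]
    simp only [S.θ_ver, zero_mul, mul_zero, sub_zero, add_zero, Finset.sum_const_zero]
    change _ + (0 : ℝ) + _ * (0 : ℝ) + _ * (0 : ℝ) = _
    ring
  · rw [happ, h0, h1, h2, h3]
    simp only [S.θ_ver, S.Q_lift, hV0, zero_mul, mul_zero, sub_zero, add_zero,
      Finset.sum_const_zero]
    rw [hsum]
    change (0 : ℝ) + _ + _ * (0 : ℝ) + _ * (0 : ℝ) = _
    rw [hα_exp, mul_zero, mul_zero, add_zero, add_zero, zero_add]
    refine Finset.sum_congr rfl fun i _ => ?_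
    rw [S.θ_lift, ← hQ2]
    rfl
  · rw [happ, h0, h1, h2, h3]
    simp only [S.θ_ver, S.Q_lift, hV0, hα0, hω0, zero_mul, mul_zero, sub_zero, add_zero, sub_self,
      Finset.sum_const_zero]
    simp only [hsum]
    change (0 : ℝ) + 0 + _ + _ * (0 : ℝ) = _
    have hsw : ωH ![v, u] ![w] m = -ωH ![u, v] ![w] m := by
      have h4 := (isAlt_of_mem_mixedForms hω).contr_swap v u
      have h5 := congrFun (congrFun h4 ![]) ![w]
      have h6 := congrArg (fun q : Fn E M => q m) h5
      exact h6
    have h7 : ∑ i, ∑ j, (S.θ i (h.lift u) * (S.θ j (h.lift v) * ωH ![S.u i, S.u j] ![S.Q w])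
        - S.θ i (h.lift v) * (S.θ j (h.lift u) * ωH ![S.u i, S.u j] ![S.Q w]) : Fn E M) m =
        ωH ![u, v] ![w] m - ωH ![v, u] ![w] m := by
      rw [hω_exp u v, hω_exp v u]
      simp only [← Finset.sum_sub_distrib]
      refine Finset.sum_congr rfl fun i _ => Finset.sum_congr rfl fun j _ => ?_
      rw [S.θ_lift, S.θ_lift, S.θ_lift, S.θ_lift, ← hQ1]
      rfl
    rw [h7, hsw]
    ring
  · rw [happ, h0, h1, h2, h3]
    simp only [S.Q_lift, hV0, hα0, hω0, mul_zero, sub_zero, add_zero,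
      Finset.sum_const_zero]
    simp only [hsum]
    change (0 : ℝ) + 0 + _ * (0 : ℝ) + _ = _
    have h7 : ∑ i, ∑ j, ∑ k, ((S.θ i (h.lift u) *
          (S.θ j (h.lift v) * S.θ k (h.lift x) - S.θ j (h.lift x) * S.θ k (h.lift v))
        - S.θ i (h.lift v) *
          (S.θ j (h.lift u) * S.θ k (h.lift x) - S.θ j (h.lift x) * S.θ k (h.lift u))
        + S.θ i (h.lift x) *
          (S.θ j (h.lift u) * S.θ k (h.lift v) - S.θ j (h.lift v) * S.θ k (h.lift u))) *
            ΦH ![S.u i, S.u j, S.u k] ![] : Fn E M) m =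
        ΦH ![u, v, x] ![] m - ΦH ![u, x, v] ![] m - ΦH ![v, u, x] ![] m + ΦH ![v, x, u] ![] m
          + ΦH ![x, u, v] ![] m - ΦH ![x, v, u] ![] m := by
      rw [hΦ_exp u v x, hΦ_exp u x v, hΦ_exp v u x, hΦ_exp v x u, hΦ_exp x u v, hΦ_exp x v u]
      simp only [← Finset.sum_sub_distrib, ← Finset.sum_add_distrib]
      refine Finset.sum_congr rfl fun i _ => Finset.sum_congr rfl fun j _ =>
        Finset.sum_congr rfl fun k _ => ?_
      simp only [S.θ_lift]
      change (u (S.x i) (p m) * (v (S.x j) (p m) * x (S.x k) (p m) -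
          x (S.x j) (p m) * v (S.x k) (p m)) -
        v (S.x i) (p m) * (u (S.x j) (p m) * x (S.x k) (p m) -
          x (S.x j) (p m) * u (S.x k) (p m)) +
        x (S.x i) (p m) * (u (S.x j) (p m) * v (S.x k) (p m) -
          v (S.x j) (p m) * u (S.x k) (p m))) * ΦH ![S.u i, S.u j, S.u k] ![] m = _
      ring
    rw [h7, ← hΦ', form_swap_12 Φ' u v x, form_swap_01 Φ' u v x, form_swap_12 Φ' v u x,
      form_cycle Φ' u v x, form_swap_12 Φ' x u v, form_cycle Φ' u v x, form_swap_01 Φ' u v x]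
    change 0 + 0 + 2⁻¹ * 0 + 6⁻¹ * (Φ' ![u, v, x] ![] m - -Φ' ![u, v, x] ![] m
      - -Φ' ![u, v, x] ![] m + -(-Φ' ![u, v, x] ![] m) + Φ' ![u, v, x] ![] m
      - -Φ' ![u, v, x] ![] m) = _
    ring

variable [FiniteDimensional ℝ F] [IsManifold 𝓘(ℝ, F) ∞ B] [T2Space B] [SecondCountableTopology B]

variable (h) in
/-- Every vertical form and mixed forms of the complementary degrees are the components of a form
on the total space. -/
lemma exists_hasComponents (ΦV : VForm p 3) {αH : Cochain p 1 2} (hα : αH ∈ mixedForms p 1 2)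
    {ωH : Cochain p 2 1} (hω : ωH ∈ mixedForms p 2 1) {ΦH : Cochain p 3 0}
    (hΦ : ΦH ∈ mixedForms p 3 0) : ∃ Φ : Form E M 3, h.HasComponents Φ ΦV αH ωH ΦH := by
  have : LocallyCompactSpace B := ChartedSpace.locallyCompactSpace F B
  choose S hS using h.exists_localSplitting
  choose U hU hUo hUmem using fun b => eventually_nhds_iff.1 (hS b)
  choose Φ hΦloc using fun b => (S b).exists_form ΦV hα hω hΦ
  obtain ⟨ρ, hρ⟩ := SmoothPartitionOfUnity.exists_isSubordinate 𝓘(ℝ, F)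
    (isClosed_univ (X := B)) U hUo fun b _ => Set.mem_iUnion.2 ⟨b, hUmem b⟩
  obtain ⟨Ψ, hΨ⟩ := exists_glued_form ρ Φ
  have key : ∀ (X : Fin 3 → VField E M) (f : Fn E M),
      (∀ b m, (S b).χ (p m) = 1 → Φ b X m = f m) → Ψ X = f := by
    intro X f hX
    ext m
    rw [hΨ]
    have h1 : ∀ b, ρ b (p m) * Φ b X m = ρ b (p m) * f m := by
      intro b
      by_cases hb : ρ b (p m) = 0
      · rw [hb, zero_mul, zero_mul]
      · rw [hX b m (hU b _ (hρ b (subset_closure hb)))]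
    rw [finsum_congr h1, ← finsum_mul' _ _ (ρ.locallyFinite.point_finite (p m)),
      ρ.sum_eq_one (Set.mem_univ _), one_mul]
  exact ⟨Ψ, fun w₀ w₁ w₂ => key _ _ fun b m hm => (hΦloc b m hm).1 w₀ w₁ w₂,
    fun u w₀ w₁ => key _ _ fun b m hm => (hΦloc b m hm).2.1 u w₀ w₁,
    fun u v w => key _ _ fun b m hm => (hΦloc b m hm).2.2.1 u v w,
    fun u v x => key _ _ fun b m hm => (hΦloc b m hm).2.2.2 u v x⟩

end EhresmannConnection

end Glue

/-! ### Closed forms that vanish on vertical vectors -/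

section Basic

variable {E F : Type*} [NormedAddCommGroup E] [NormedSpace ℝ E]
  [NormedAddCommGroup F] [NormedSpace ℝ F]
  {M B : Type*} [TopologicalSpace M] [ChartedSpace E M] [TopologicalSpace B] [ChartedSpace F B]
  {p : C^∞⟮𝓘(ℝ, E), M; 𝓘(ℝ, F), B⟯}

/-- The de Rham differential of a form is a form, and it is closed. -/
lemma exists_form_eq_extD {k : ℕ} (Φ : Form E M k) :
    ∃ Ξ : Form E M (k + 1), ⇑Ξ = extD E M k Φ ∧ extD E M (k + 1) Ξ = 0 := by
  have hΦ : IsAlt (Fn E M) ⇑Φ := ⟨Φ, rfl⟩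
  obtain ⟨Ξ, hΞ⟩ := hΦ.extDerivative
  refine ⟨Ξ, hΞ, ?_⟩
  rw [hΞ]
  exact koszul_koszul hΦ

lemma pullbackForm_mem_mixedForms {k : ℕ} (φ : Form F B k) :
    pullbackForm p φ ∈ mixedForms p k 0 := by
  refine ⟨fun v => ?_, fun v i u u' => ?_, fun v i g u w => ?_, fun v i j hij hv => ?_⟩
  · obtain ⟨η, hη⟩ := isAlt_zero_arg (R := Fn E M) (pullbackForm p φ v)
    exact ⟨η, hη.symm⟩
  · funext w
    change (φ _).comp p = (φ _).comp p + (φ _).comp p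
    rw [φ.map_update_add]
    rfl
  · change (φ _).comp p = g.comp p * (φ _).comp p
    rw [φ.map_update_smul]
    rfl
  · funext w
    change (φ v).comp p = 0
    rw [φ.map_eq_zero_of_eq v hv hij]
    rfl

lemma dV_pullbackForm {k : ℕ} (φ : Form F B k) : dV p k 0 (pullbackForm p φ) = 0 := by
  funext v w
  rw [dV_zero_apply]
  change _ • (w 0 : VField E M) ((φ v).comp p) = 0
  rw [(w 0).2, smul_zero]

/-- A form that is killed by contraction with vertical fields vanishes as soon as one of its
arguments is vertical. -/
lemma form_eq_zero_of_ver_arg {k : ℕ} {Ξ : Form E M (k + 1)}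
    (hΞ : ∀ w : Ver p, Ξ.curryLeft (w : VField E M) = 0) (X : Fin (k + 1) → VField E M)
    (j : Fin (k + 1)) (hX : X j ∈ Ver p) : Ξ X = 0 := by
  have h1 := Ξ.neg_one_pow_smul_map_insertNth j (X j) (j.removeNth X)
  rw [Fin.insertNth_self_removeNth] at h1
  have h2 : Ξ (Matrix.vecCons (X j) (j.removeNth X)) = 0 :=
    congrArg (fun η : Form E M k => η (j.removeNth X)) (hΞ ⟨X j, hX⟩)
  rw [h2] at h1
  rcases Nat.even_or_odd (j : ℕ) with hj | hj
  · simpa [hj.neg_one_pow] using h1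
  · simpa [hj.neg_one_pow] using h1

namespace EhresmannConnection

variable (h : EhresmannConnection p)

/-- The horizontal component `Ξ^{(k,0)}` of a form, its values on horizontal lifts. -/
def horizontal {k : ℕ} (Ξ : Form E M k) : Cochain p k 0 := fun v _ => Ξ fun i => h.lift (v i)

lemma lift_update {k : ℕ} (v : Fin k → VField F B) (i : Fin k) (u : VField F B) :
    (fun j => h.lift (Function.update v i u j)) =
      Function.update (fun j => h.lift (v j)) i (h.lift u) := by
  funext j
  exact Function.apply_update (fun _ => h.lift) v i u j

lemma horizontal_mem_mixedForms {k : ℕ} (Ξ : Form E M k) : h.horizontal Ξ ∈ mixedForms p k 0 := by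
  refine ⟨fun v => ?_, fun v i u u' => ?_, fun v i g u w => ?_, fun v i j hij hv => ?_⟩
  · obtain ⟨η, hη⟩ := isAlt_zero_arg (R := Fn E M) (h.horizontal Ξ v)
    exact ⟨η, hη.symm⟩
  · funext w
    change Ξ _ = Ξ _ + Ξ _
    rw [h.lift_update, h.lift_update, h.lift_update, h.lift_add, Ξ.map_update_add]
  · change Ξ _ = g.comp p * Ξ _
    rw [h.lift_update, h.lift_update, h.lift_smul, Ξ.map_update_smul]
    rfl
  · funext w
    exact Ξ.map_eq_zero_of_eq _ (congrArg h.lift hv) hij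

lemma dH_zero_apply {k : ℕ} (Θ : Cochain p k 0) (v : Fin (k + 1) → VField F B) (w : Fin 0 → Ver p) :
    h.dH k 0 Θ v w = (∑ i : Fin (k + 1), (-1 : ℝ) ^ (i : ℕ) •
      h.lift (v i) (Θ (fun l => v (i.succAbove l)) w)) + koszulBracket Θ v w := by
  obtain rfl : w = ![] := Subsingleton.elim _ _
  change (koszulAction (h.lieDeriv 0) Θ v + koszulBracket Θ v) ![] = _
  rw [Pi.add_apply, koszulAction, Finset.sum_apply]
  congr 1
  refine Finset.sum_congr rfl fun i _ => ?_
  rw [Pi.smul_apply, lieDeriv_zero_apply]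

lemma koszulBracket_apply {k s : ℕ} (Θ : Cochain p (k + 1) s) (v : Fin (k + 2) → VField F B)
    (w : Fin s → Ver p) : koszulBracket Θ v w = ∑ j : Fin (k + 2), ∑ i : Fin (k + 1),
      if i.castSucc < j then (-1 : ℝ) ^ ((i : ℕ) + (j : ℕ)) •
        Θ (Fin.cons ⁅v i.castSucc, v j⁆ fun l => v (j.succAbove (i.succAbove l))) w else 0 := by
  simp only [koszulBracket, Finset.sum_apply]
  refine Finset.sum_congr rfl fun j _ => Finset.sum_congr rfl fun i _ => ?_
  split_ifs <;> rfl

lemma dH_pullbackForm {k : ℕ} (φ : Form F B k) (v : Fin (k + 1) → VField F B)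
    (w : Fin 0 → Ver p) : h.dH k 0 (pullbackForm p φ) v w = (extD F B k φ v).comp p := by
  let c : Fn F B →+ Fn E M := ⟨⟨fun g => g.comp p, rfl⟩, fun _ _ => rfl⟩
  have hc : ∀ (r : ℝ) g, c (r • g) = r • c g := fun _ _ => rfl
  rw [dH_zero_apply]
  change _ = c (koszulAction _ _ _ + koszulBracket _ _)
  rw [map_add, koszulAction, map_sum]
  congr 1
  · refine Finset.sum_congr rfl fun i _ => ?_
    rw [hc]
    exact congrArg _ (h.lift_apply_comp _ _)
  · cases k with
    | zero => rfl
    | succ k =>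
      rw [koszulBracket_apply, koszulBracket, map_sum]
      refine Finset.sum_congr rfl fun j _ => ?_
      rw [map_sum]
      refine Finset.sum_congr rfl fun i _ => ?_
      split_ifs
      · rfl
      · rfl

/-- On a form that vanishes on vertical vectors, the horizontal part of the de Rham differential is
`d^H` of the horizontal part: brackets of lifts are lifts of brackets up to vertical fields. -/
lemma extD_lift {k : ℕ} {Ξ : Form E M (k + 1)}
    (hΞ : ∀ w : Ver p, Ξ.curryLeft (w : VField E M) = 0) (v : Fin (k + 2) → VField F B)
    (w : Fin 0 → Ver p) :
    extD E M (k + 1) Ξ (fun i => h.lift (v i)) = h.dH (k + 1) 0 (h.horizontal Ξ) v w := by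
  rw [dH_zero_apply]
  change koszulAction derAct ⇑Ξ _ + koszulBracket ⇑Ξ _ = _
  congr 1
  rw [koszulBracket_apply, koszulBracket]
  refine Finset.sum_congr rfl fun j _ => Finset.sum_congr rfl fun i _ => ?_
  split_ifs
  · congr 1
    let Y : Fin k → VField E M := fun l => h.lift (v (j.succAbove (i.succAbove l)))
    have h1 := congrArg (fun η : Form E M k => η Y) (hΞ (h.curvature (v i.castSucc) (v j)))
    have h2 : Ξ.curryLeft ⁅h.lift (v i.castSucc), h.lift (v j)⁆ Y =
        Ξ.curryLeft (h.lift ⁅v i.castSucc, v j⁆) Y := by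
      rw [lie_lift_lift, map_add, AlternatingMap.add_apply]
      exact add_eq_left.2 h1
    refine h2.trans ?_
    change Ξ _ = Ξ _
    congr 1
    funext l
    refine Fin.cases rfl (fun l => rfl) l
  · rfl

/-- For a closed form that vanishes on vertical vectors, the values on horizontal lifts are
constant along the fibres: the Lie derivative along a vertical field vanishes, and `[w, h(u)]` is
vertical. -/
lemma dV_horizontal {k : ℕ} {Ξ : Form E M (k + 1)} (hcl : extD E M (k + 1) Ξ = 0)
    (hΞ : ∀ w : Ver p, Ξ.curryLeft (w : VField E M) = 0) :
    dV p (k + 1) 0 (h.horizontal Ξ) = 0 := by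
  funext v w
  rw [dV_zero_apply]
  have hc : contr (w 0 : VField E M) ⇑Ξ = 0 := by
    funext Y
    exact congrArg (fun η : Form E M k => η Y) (hΞ (w 0))
  have h1 := contr_koszul derAct (w 0 : VField E M) (⟨Ξ, rfl⟩ : IsAlt (Fn E M) ⇑Ξ)
  rw [hc, map_zero, sub_zero] at h1
  have h2 : (0 : Fn E M) = lieD derAct (w 0 : VField E M) ⇑Ξ fun i => h.lift (v i) := by
    rw [← h1]
    exact (congrFun hcl _).symm
  rw [lieD, Finset.sum_eq_zero, sub_zero] at h2
  · change _ • (w 0 : VField E M) (Ξ fun i => h.lift (v i)) = 0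
    rw [show (w 0 : VField E M) (Ξ fun i => h.lift (v i)) = 0 from h2.symm, smul_zero]
  · intro j _
    refine form_eq_zero_of_ver_arg hΞ _ j ?_
    rw [Function.update_self, ← lie_skew, lie_lift_ver]
    exact neg_mem (h.lieVer (v j) (w 0)).2

/-- A closed form that vanishes on vertical vectors is the pull-back of a unique closed form on the
base. -/
lemma existsUnique_pullbackForm_eq [FiniteDimensional ℝ E] [IsManifold 𝓘(ℝ, E) ∞ M] [T2Space M]
    (hp : Manifold.IsSubmersion 𝓘(ℝ, E) 𝓘(ℝ, F) ∞ p) (hfib : ∀ b : B, IsConnected (p ⁻¹' {b}))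
    {k : ℕ} {Ξ : Form E M (k + 1)} (hcl : extD E M (k + 1) Ξ = 0)
    (hΞ : ∀ w : Ver p, Ξ.curryLeft (w : VField E M) = 0) :
    ∃! φ : closedForms F B (k + 1), pullbackForm p (φ : Form F B (k + 1)) = h.horizontal Ξ := by
  obtain ⟨φ, hφ⟩ := exists_pullbackForm_eq hp hfib (h.horizontal_mem_mixedForms Ξ)
    (h.dV_horizontal hcl hΞ)
  refine ⟨⟨φ, ?_⟩, hφ, fun ψ hψ => ?_⟩
  · funext v
    refine comp_injective hfib ?_
    rw [← h.dH_pullbackForm φ v Fin.elim0, hφ, ← h.extD_lift hΞ, hcl]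
    rfl
  · refine Subtype.ext (AlternatingMap.ext fun v => comp_injective hfib ?_)
    exact congrFun (congrFun (hψ.trans hφ.symm) v) Fin.elim0

namespace HasComponents

variable {h} {Φ : Form E M 3} {ΦV : VForm p 3} {αH : Cochain p 1 2} {ωH : Cochain p 2 1}
  {ΦH : Cochain p 3 0}

lemma horizontal_eq (H : h.HasComponents Φ ΦV αH ωH ΦH) {Ξ : Form E M 4}
    (hΞ : ⇑Ξ = extD E M 3 Φ) : h.horizontal Ξ = h.dH 3 0 ΦH + h.dC ωH := by
  funext v w
  have hv : v = ![v 0, v 1, v 2, v 3] := by funext i; fin_cases i <;> rfl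
  obtain rfl : w = ![] := Subsingleton.elim _ _
  conv_rhs => rw [hv]
  rw [← H.extD_40, ← hΞ]
  change Ξ _ = Ξ _
  congr 1
  funext i
  fin_cases i <;> rfl

lemma isExtension (H : h.HasComponents Φ ΦV αH ωH ΦH) : IsExtension ΦV Φ := by
  intro w
  have h1 := H.comp03 (w 0) (w 1) (w 2)
  have h2 : w = ![w 0, w 1, w 2] := by funext i; fin_cases i <;> rfl
  rw [h2, ← h1]
  congr 1
  funext i
  fin_cases i <;> rfl

lemma component_one_two (H : h.HasComponents Φ ΦV αH ωH ΦH) :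
    h.component (r := 1) (s := 2) Φ = αH := by
  funext v w
  have hv : v = ![v 0] := by funext i; fin_cases i; rfl
  have hw : w = ![w 0, w 1] := by funext i; fin_cases i <;> rfl
  rw [hv, hw, ← H.comp12]
  change Φ _ = Φ _
  congr 1
  funext i
  fin_cases i <;> rfl

lemma component_two_one (H : h.HasComponents Φ ΦV αH ωH ΦH) :
    h.component (r := 2) (s := 1) Φ = ωH := by
  funext v w
  have hv : v = ![v 0, v 1] := by funext i; fin_cases i <;> rfl
  have hw : w = ![w 0] := by funext i; fin_cases i; rfl
  rw [hv, hw, ← H.comp21]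
  change Φ _ = Φ _
  congr 1
  funext i
  fin_cases i <;> rfl

variable [FiniteDimensional ℝ F] [IsManifold 𝓘(ℝ, F) ∞ B] [T2Space B]

/-- If the components satisfy the equations of degrees `(0,4)`, `(1,3)`, `(2,2)` and `(3,1)`, then
`dΦ` vanishes on vertical vectors. -/
lemma curryLeft_ver_eq_zero (H : h.HasComponents Φ ΦV αH ωH ΦH)
    (h04 : dV p 0 3 ΦV.toCochain = 0) (h13 : h.dH 0 3 ΦV.toCochain + dV p 1 2 αH = 0)
    (h22 : h.dC ΦV.toCochain + h.dH 1 2 αH + dV p 2 1 ωH = 0)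
    (h31 : h.dC αH + h.dH 2 1 ωH + dV p 3 0 ΦH = 0) {Ξ : Form E M 4}
    (hΞ : ⇑Ξ = extD E M 3 Φ) (w : Ver p) : Ξ.curryLeft (w : VField E M) = 0 := by
  refine h.curryLeft_ver_eq_zero Ξ (fun r X hr hl hv => ?_) w
  have hX : X = ![X 0, X 1, X 2, X 3] := by funext i; fin_cases i <;> rfl
  rw [hΞ, hX]
  interval_cases r
  · have := H.extD_04 ⟨X 0, hv 0 (by decide)⟩ ⟨X 1, hv 1 (by decide)⟩ ⟨X 2, hv 2 (by decide)⟩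
      ⟨X 3, hv 3 (by decide)⟩
    rw [h04] at this
    exact this
  · obtain ⟨u, hu⟩ := hl 0 (by decide)
    have := H.extD_13 u ⟨X 1, hv 1 (by decide)⟩ ⟨X 2, hv 2 (by decide)⟩ ⟨X 3, hv 3 (by decide)⟩
    rw [h13] at this
    rw [← hu]
    exact this
  · obtain ⟨u, hu⟩ := hl 0 (by decide)
    obtain ⟨v, hv'⟩ := hl 1 (by decide)
    have := H.extD_22 u v ⟨X 2, hv 2 (by decide)⟩ ⟨X 3, hv 3 (by decide)⟩
    rw [h22] at this
    rw [← hu, ← hv']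
    exact this
  · obtain ⟨u, hu⟩ := hl 0 (by decide)
    obtain ⟨v, hv'⟩ := hl 1 (by decide)
    obtain ⟨x, hx⟩ := hl 2 (by decide)
    have := H.extD_31 u v x ⟨X 3, hv 3 (by decide)⟩
    rw [h31] at this
    rw [← hu, ← hv', ← hx]
    exact this

/-- A form is closed if its components satisfy the equations of all five degrees. -/
lemma isClosedForm (H : h.HasComponents Φ ΦV αH ωH ΦH)
    (h04 : dV p 0 3 ΦV.toCochain = 0) (h13 : h.dH 0 3 ΦV.toCochain + dV p 1 2 αH = 0)
    (h22 : h.dC ΦV.toCochain + h.dH 1 2 αH + dV p 2 1 ωH = 0)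
    (h31 : h.dC αH + h.dH 2 1 ωH + dV p 3 0 ΦH = 0) (h40 : h.dH 3 0 ΦH + h.dC ωH = 0) :
    IsClosedForm Φ := by
  obtain ⟨Ξ, hΞ, -⟩ := exists_form_eq_extD Φ
  have h1 := H.curryLeft_ver_eq_zero h04 h13 h22 h31 hΞ
  have h2 : Ξ = 0 := by
    refine h.form_eq_zero_of_components Ξ fun r X hr hl hv => ?_
    rcases hr.lt_or_eq with hr | rfl
    · exact form_eq_zero_of_ver_arg h1 X 3 (hv 3 (by simp; omega))
    · choose v hv' using fun i : Fin 4 => hl i i.2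
      have h3 := congrFun (congrFun ((H.horizontal_eq hΞ).trans h40) v) Fin.elim0
      rw [← funext hv']
      exact h3
  change extD E M 3 Φ = 0
  rw [← hΞ, h2]
  rfl

end HasComponents

lemma hasComponents_of_component_eq {Φ : Form E M 3} {ΦV : VForm p 3} {αH : Cochain p 1 2}
    {ωH : Cochain p 2 1} (hV : IsExtension ΦV Φ) (hα : h.component (r := 1) (s := 2) Φ = αH)
    (hω : h.component (r := 2) (s := 1) Φ = ωH) :
    h.HasComponents Φ ΦV αH ωH (h.horizontal Φ) := by
  subst hα hω
  refine ⟨fun w₀ w₁ w₂ => ?_, fun u w₀ w₁ => ?_, fun u v w => ?_, fun u v x => ?_⟩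
  · rw [← hV]
    congr 1
    funext i
    fin_cases i <;> rfl
  all_goals
    change Φ _ = Φ _
    congr 1
    funext i
    fin_cases i <;> rfl

end EhresmannConnection

end Basic

end TwoPlectic

end

theorem mainTheorem9
    {E F : Type*} [NormedAddCommGroup E] [NormedSpace ℝ E] [FiniteDimensional ℝ E]
    [NormedAddCommGroup F] [NormedSpace ℝ F] [FiniteDimensional ℝ F]
    {M B : Type*}
    [TopologicalSpace M] [ChartedSpace E M] [IsManifold 𝓘(ℝ, E) ∞ M]
    [T2Space M] [SecondCountableTopology M]
    [TopologicalSpace B] [ChartedSpace F B] [IsManifold 𝓘(ℝ, F) ∞ B]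
    [T2Space B] [SecondCountableTopology B]
    (p : C^∞⟮𝓘(ℝ, E), M; 𝓘(ℝ, F), B⟯) (ΦV : TwoPlectic.VForm p 3)
    (hΦV : TwoPlectic.IsTwoPlecticFibration p ΦV)
    (hfib : ∀ b : B, IsConnected (p ⁻¹' {b}))
    (h : TwoPlectic.EhresmannConnection p) (hcomp : h.IsCompatible ΦV)
    (hobs₁ : h.class₂ 1 1 (h.dC ΦV.toCochain) = 0) :
    (∃ αH ∈ TwoPlectic.mixedForms p 1 2, ∃ ωH ∈ TwoPlectic.mixedForms p 2 1,
      h.dH 0 3 ΦV.toCochain + TwoPlectic.dV p 1 2 αH = 0 ∧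
      h.dC ΦV.toCochain + h.dH 1 2 αH + TwoPlectic.dV p 2 1 ωH = 0) ∧
    ∀ αH ∈ TwoPlectic.mixedForms p 1 2, ∀ ωH ∈ TwoPlectic.mixedForms p 2 1,
      h.dH 0 3 ΦV.toCochain + TwoPlectic.dV p 1 2 αH = 0 →
      h.dC ΦV.toCochain + h.dH 1 2 αH + TwoPlectic.dV p 2 1 ωH = 0 →
      TwoPlectic.class₁ p 3 0 (h.dH 2 1 ωH + h.dC αH) = 0 →
      (∃ ΦH ∈ TwoPlectic.mixedForms p 3 0,
        h.dC αH + h.dH 2 1 ωH + TwoPlectic.dV p 3 0 ΦH = 0) ∧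
      ∀ ΦH ∈ TwoPlectic.mixedForms p 3 0,
        h.dC αH + h.dH 2 1 ωH + TwoPlectic.dV p 3 0 ΦH = 0 →
        (∃! φ : TwoPlectic.closedForms F B 4,
          TwoPlectic.pullbackForm p (φ : TwoPlectic.Form F B 4) = h.dH 3 0 ΦH + h.dC ωH) ∧
        ∀ φ : TwoPlectic.closedForms F B 4,
          TwoPlectic.pullbackForm p (φ : TwoPlectic.Form F B 4) = h.dH 3 0 ΦH + h.dC ωH →
          ((Submodule.Quotient.mk φ : TwoPlectic.DeRhamSucc F B 3) = 0 ↔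
            ∃ Φ : TwoPlectic.Form E M 3, TwoPlectic.IsClosedForm Φ ∧
              TwoPlectic.IsExtension ΦV Φ ∧
              h.component (r := 1) (s := 2) Φ = αH ∧ h.component (r := 2) (s := 1) Φ = ωH) ∧
          ((Submodule.Quotient.mk φ : TwoPlectic.DeRhamSucc F B 3) = 0 →
            ∃ Φ : TwoPlectic.Form E M 3, TwoPlectic.IsClosedForm Φ ∧
              TwoPlectic.IsExtension ΦV Φ) := by
  refine ⟨?_, fun αH hα ωH hω h13 h22 hobs₂ => ⟨?_, fun ΦH hΦ h31 => ?_⟩⟩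
  · obtain ⟨_, ⟨y, ⟨hy, hyV⟩, rfl⟩, _, ⟨z, hz, rfl⟩, hyz⟩ :=
      Submodule.mem_sup.1 ((Submodule.Quotient.mk_eq_zero _).1 hobs₁)
    refine ⟨-y, neg_mem hy, -z, neg_mem hz, ?_, ?_⟩
    · rw [map_neg, LinearMap.mem_ker.1 hyV, neg_zero, add_zero]
      exact hcomp
    · rw [map_neg, map_neg, ← hyz]
      abel
  · obtain ⟨z, hz, hzd⟩ := (Submodule.Quotient.mk_eq_zero _).1 hobs₂
    refine ⟨-z, neg_mem hz, ?_⟩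
    rw [map_neg, hzd]
    abel
  have hsub := hΦV.fibration.submersion
  have h04 := hΦV.closed
  have hexact : ∀ φ : TwoPlectic.closedForms F B 4,
      TwoPlectic.pullbackForm p (φ : TwoPlectic.Form F B 4) = h.dH 3 0 ΦH + h.dC ωH →
      ((Submodule.Quotient.mk φ : TwoPlectic.DeRhamSucc F B 3) = 0 ↔
        ∃ Φ : TwoPlectic.Form E M 3, TwoPlectic.IsClosedForm Φ ∧ TwoPlectic.IsExtension ΦV Φ ∧
          h.component (r := 1) (s := 2) Φ = αH ∧ h.component (r := 2) (s := 1) Φ = ωH) := by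
    intro φ hφ
    rw [Submodule.Quotient.mk_eq_zero]
    constructor
    · rintro ⟨η, hη⟩
      -- a primitive of `φ` corrects the horizontal component without affecting the other equations
      obtain ⟨Φ, H⟩ := h.exists_hasComponents ΦV hα hω
        (sub_mem hΦ (TwoPlectic.pullbackForm_mem_mixedForms η))
      refine ⟨Φ, H.isClosedForm h04 h13 h22 ?_ ?_, H.isExtension, H.component_one_two,
        H.component_two_one⟩
      · rw [map_sub, TwoPlectic.dV_pullbackForm, sub_zero, h31]
      · rw [map_sub, sub_add_eq_add_sub, ← hφ, sub_eq_zero]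
        funext v w
        rw [h.dH_pullbackForm, hη]
        rfl
    · rintro ⟨Φ, hcl, hV, hΦα, hΦω⟩
      have H := h.hasComponents_of_component_eq hV hΦα hΦω
      have h31' : h.dC αH + h.dH 2 1 ωH + TwoPlectic.dV p 3 0 (h.horizontal Φ) = 0 := by
        funext v w
        have hv : v = ![v 0, v 1, v 2] := by funext i; fin_cases i <;> rfl
        have hw : w = ![w 0] := by funext i; fin_cases i; rfl
        rw [hv, hw, ← H.extD_31, show TwoPlectic.extD E M 3 Φ = 0 from hcl]
        rfl
      have h40' : h.dH 3 0 (h.horizontal Φ) + h.dC ωH = 0 := by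
        rw [← H.horizontal_eq (Ξ := 0) hcl.symm]
        rfl
      -- two solutions of the equation in degree `(3,1)` differ by the pull-back of a form
      obtain ⟨η, hη⟩ := TwoPlectic.exists_pullbackForm_eq hsub hfib
        (sub_mem hΦ (h.horizontal_mem_mixedForms Φ)) (by
          rw [map_sub, sub_eq_zero]
          exact add_left_cancel (h31.trans h31'.symm))
      refine ⟨η, ?_⟩
      funext v
      refine TwoPlectic.comp_injective hfib ?_
      rw [← h.dH_pullbackForm η v Fin.elim0, hη, map_sub,
        ← add_sub_add_right_eq_sub _ _ (h.dC ωH), h40', sub_zero, ← hφ]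
      rfl
  refine ⟨?_, fun φ hφ => ⟨hexact φ hφ, fun h0 => ?_⟩⟩
  · obtain ⟨Φ, H⟩ := h.exists_hasComponents ΦV hα hω hΦ
    obtain ⟨Ξ, hΞ, hcl⟩ := TwoPlectic.exists_form_eq_extD Φ
    rw [← H.horizontal_eq hΞ]
    exact h.existsUnique_pullbackForm_eq hsub hfib hcl
      (H.curryLeft_ver_eq_zero h04 h13 h22 h31 hΞ)
  · obtain ⟨Φ, hcl, hV, -⟩ := (hexact φ hφ).1 h0
    exact ⟨Φ, hcl, hV⟩
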